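/- Conventions. Let $k$ be a field. All quivers are finite and connected. For a quiver $Q$, the path algebra $kQ$ has the paths of $Q$ (including a stationary path at each vertex) as a basis, with composition of paths (or $0$) as product; $F\subset kQ$ is the two-sided ideal generated by the arrows. A two-sided ideal $I$ of $kQ$ is admissible if $F^m\subseteq I\subseteq F^2$ for some $m\ge 2$. A pair $(Q,I)$ is a presentation of a $k$-algebra $A$ if $I$ is admissible and is the kernel of a surjective algebra morphism $kQ\to A$; $A$ is triangular if it has such a presentation in which $Q$ (which is determined by $A$) has no oriented cycle. A minimal relation of $I$ is an element $\sum_{i=1}^m\lambda_iw_i\in I$ with $m\ge2$, $\lambda_i\in k\setminus\{0\}$ and $w_i$ distinct parallel paths, such that $\sum_{i\in J}\lambda_iw_i\notin I$ for every nonempty proper subset $J\subset\{1,\dots,m\}$. Homotopy is the smallest equivalence relation on the walks of $Q$ (compositions of arrows and formal inverses of arrows) which is compatible with composition, with $\alpha\alpha^{-1}\sim e_{x}$ and $\alpha^{-1}\alpha\sim e_{y}$ for every arrow $\alpha:x\to y$, and $w_i\sim w_j$ for all paths $w_i,w_j$ in a common minimal relation. The fundamental group $\pi_1(Q,I)$ is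 the group of homotopy classes of closed walks at a base point. The coproduct $(Q',I')\sqcup(Q'',I'')$ of bound quivers with base points $v',v''$ is obtained from the disjoint union of $Q'$ and $Q''$ by identifying $v'$ with $v''$, with the ideal generated by $I'$ and $I''$. A group $H$ is said to be without free generators if it has a finite presentation $\langle S\mid R\rangle$ in which every generator occurs in the reduced word of some relator. $\mathbb Z^{\sqcup m}$ is the free group of rank $m$ and $\sqcup$ denotes the free product of groups. Proposition. Let $k$ be a field and let $G$ be a finitely presented group. Then there are a triangular $k$-algebra $A$, a quiver $Q_G$ without oriented cycles and two presentations $(Q_G,J_G)$ and $(Q_G,\bar J_G)$ of $A$ such that, for every choice of the base point, $\pi_1(Q_G,J_G)\cong G$ and $\pi_1(Q_G,\bar J_G)$ is trivial. More precisely, $G\cong\mathbb Z^{\sqcup m}\sqcup H$ for some $m\ge0$ and some finitely presented group $H$ without free generators; and for every such decomposition of $G$ the above $A$, $Q_G$, $J_G$, $\bar J_G$ can be chosen so that $(Q_G,J_G)=(O,L)\sqcup(Q_H,I)$ and $(Q_G,\bar J_G)=(O,\bar L)\sqcup(Q_H,\bar I)$, with the same base points in $O$ and $Q_H$ for both coproducts,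 where $O$ and $Q_H$ are quivers without oriented cycles, $(O,L)$ and $(O,\bar L)$ are presentations of one triangular algebra with $\pi_1(O,L)\cong\mathbb Z^{\sqcup m}$ and $\pi_1(O,\bar L)$ trivial, and $(Q_H,I)$ and $(Q_H,\bar I)$ are presentations of one triangular algebra with $\pi_1(Q_H,I)\cong H$ and $\pi_1(Q_H,\bar I)$ trivial (again for every choice of the base points of the fundamental groups). -/

import Mathlib

universe u v w

noncomputable section

namespace BoundQuiver

/-! ### Finite connected quivers -/

/-- The quivers under consideration: finitely many vertices, finitely many arrows, and connected
underlying graph (nonempty, and any two vertices are joined by a walk). A walk is a path in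
`Quiver.Symmetrify`, in which a formal inverse has been added for each arrow. -/
structure FinConnQuiver where
  Vert : Type
  [quiver : Quiver.{0} Vert]
  [fintypeVert : Fintype Vert]
  [finiteHom : ∀ x y : Vert, Finite (x ⟶ y)]
  nonempty : Nonempty Vert
  connected : ∀ x y : Quiver.Symmetrify Vert, Nonempty (Quiver.Path x y)

attribute [instance] FinConnQuiver.quiver FinConnQuiver.fintypeVert FinConnQuiver.finiteHom

/-- No oriented cycles: every path from a vertex to itself is stationary. -/
def IsAcyclic (V : Type*) [Quiver V] : Prop :=
  ∀ (x : V) (p : Quiver.Path x x), p = Quiver.Path.nil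

/-! ### The path algebra -/

/-- A path of a quiver together with its source and its target. -/
structure TotalPath (V : Type*) [Quiver V] where
  src : V
  tgt : V
  path : Quiver.Path src tgt

/-- The path algebra `kQ`: the vector space with basis the paths of `Q`, including the stationary
path at each vertex. -/
def PathAlgebra (k : Type*) (V : Type*) [Field k] [Quiver V] := TotalPath V →₀ k

namespace PathAlgebra

variable {k : Type*} {V : Type*} [Field k] [Quiver V]

instance : AddCommGroup (PathAlgebra k V) := inferInstanceAs (AddCommGroup (TotalPath V →₀ k))
instance : Module k (PathAlgebra k V) := inferInstanceAs (Module k (TotalPath V →₀ k))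

/-- The basis element given by a path. -/
def ofPath {x y : V} (p : Quiver.Path x y) : PathAlgebra k V :=
  Finsupp.single (⟨x, y, p⟩ : TotalPath V) (1 : k)

/-- The product of two basis elements: their composition if it is possible, `0` otherwise. -/
def basisMul (p q : TotalPath V) : PathAlgebra k V :=
  open Classical in
  if h : q.src = p.tgt then ofPath (p.path.comp (q.path.cast h rfl)) else 0

/-- The bilinear extension of `basisMul`. -/
def mulHom : PathAlgebra k V →ₗ[k] PathAlgebra k V →ₗ[k] PathAlgebra k V :=
  Finsupp.linearCombination k fun p : TotalPath V =>
    (Finsupp.linearCombination k fun q : TotalPath V =>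
      (basisMul p q : PathAlgebra k V) : (TotalPath V →₀ k) →ₗ[k] PathAlgebra k V)

instance : Mul (PathAlgebra k V) := ⟨fun f g => mulHom f g⟩

/-- The unit is the sum of the stationary paths. -/
instance [Fintype V] : One (PathAlgebra k V) :=
  ⟨∑ x : V, ofPath (Quiver.Path.nil : Quiver.Path x x)⟩

theorem mul_def (f g : PathAlgebra k V) : f * g = mulHom f g := rfl

theorem one_def [Fintype V] :
    (1 : PathAlgebra k V) = ∑ x : V, ofPath (Quiver.Path.nil : Quiver.Path x x) := rfl

theorem ofPath_mul_ofPath {x y x' y' : V} (p : Quiver.Path x y) (q : Quiver.Path x' y') :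
    (ofPath p * ofPath q : PathAlgebra k V) = basisMul ⟨x, y, p⟩ ⟨x', y', q⟩ := by
  have h1 : mulHom (ofPath p : PathAlgebra k V) =
      (Finsupp.linearCombination k fun q : TotalPath V =>
        (basisMul ⟨x, y, p⟩ q : PathAlgebra k V)) :=
    (Finsupp.linearCombination_single k (1 : k) (⟨x, y, p⟩ : TotalPath V)).trans (one_smul k _)
  have h2 : (Finsupp.linearCombination k fun q : TotalPath V =>
      (basisMul ⟨x, y, p⟩ q : PathAlgebra k V)) (ofPath q) = basisMul ⟨x, y, p⟩ ⟨x', y', q⟩ :=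
    (Finsupp.linearCombination_single k (1 : k) (⟨x', y', q⟩ : TotalPath V)).trans (one_smul k _)
  exact (congrArg (fun T => T (ofPath q)) h1).trans h2

theorem ofPath_mul_ofPath_comp {x y z : V} (p : Quiver.Path x y) (q : Quiver.Path y z) :
    (ofPath p * ofPath q : PathAlgebra k V) = ofPath (p.comp q) := by
  rw [ofPath_mul_ofPath, basisMul, dif_pos rfl]
  rfl

theorem ofPath_mul_ofPath_ne {x y x' y' : V} (p : Quiver.Path x y) (q : Quiver.Path x' y')
    (h : x' ≠ y) : (ofPath p * ofPath q : PathAlgebra k V) = 0 := by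
  rw [ofPath_mul_ofPath, basisMul, dif_neg h]

/-- Two linear maps that agree on paths are equal. -/
theorem lhom_ext {M : Type*} [AddCommGroup M] [Module k M] {f g : PathAlgebra k V →ₗ[k] M}
    (h : ∀ (x y : V) (p : Quiver.Path x y), f (ofPath p) = g (ofPath p)) : f = g :=
  Finsupp.lhom_ext' fun p => LinearMap.ext_ring (h p.src p.tgt p.path)

theorem mulHom_ofPath_assoc {x y x' y' x'' y'' : V} (p : Quiver.Path x y) (q : Quiver.Path x' y')
    (r : Quiver.Path x'' y'') :
    (ofPath p * ofPath q * ofPath r : PathAlgebra k V) = ofPath p * (ofPath q * ofPath r) := by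
  by_cases h : x' = y
  · subst h
    by_cases h' : x'' = y'
    · subst h'
      simp only [ofPath_mul_ofPath_comp, Quiver.Path.comp_assoc]
    · rw [ofPath_mul_ofPath_comp, ofPath_mul_ofPath_ne _ _ h', ofPath_mul_ofPath_ne _ _ h']
      exact (map_zero (mulHom (ofPath p))).symm
  · rw [ofPath_mul_ofPath_ne _ _ h]
    have h0 : (0 * ofPath r : PathAlgebra k V) = 0 := by
      rw [mul_def, map_zero, LinearMap.zero_apply]
    rw [h0]
    by_cases h' : x'' = y'
    · subst h'
      rw [ofPath_mul_ofPath_comp, ofPath_mul_ofPath_ne _ _ h]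
    · rw [ofPath_mul_ofPath_ne _ _ h']
      exact (map_zero (mulHom (ofPath p))).symm

theorem mul_assoc' (f g h : PathAlgebra k V) : f * g * h = f * (g * h) := by
  let L : PathAlgebra k V →ₗ[k] PathAlgebra k V →ₗ[k] PathAlgebra k V →ₗ[k] PathAlgebra k V :=
    (mulHom (k := k) (V := V)).compr₂ mulHom
  let R : PathAlgebra k V →ₗ[k] PathAlgebra k V →ₗ[k] PathAlgebra k V →ₗ[k] PathAlgebra k V :=
    LinearMap.mk₂ k (fun f g => (mulHom f) ∘ₗ (mulHom g))
      (by intros; ext1; simp) (by intros; ext1; simp) (by intros; ext1; simp)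
      (by intros; ext1; simp)
  have hLR : L = R := by
    refine lhom_ext fun x y p => lhom_ext fun x' y' q => lhom_ext fun x'' y'' r => ?_
    exact mulHom_ofPath_assoc p q r
  exact congrArg (fun T => T f g h) hLR

theorem one_mul' [Fintype V] (f : PathAlgebra k V) : 1 * f = f := by
  have h : mulHom (1 : PathAlgebra k V) = LinearMap.id := by
    refine lhom_ext fun x y p => ?_
    rw [one_def, map_sum, LinearMap.sum_apply, Finset.sum_eq_single x]
    · change ofPath _ * ofPath p = _
      rw [ofPath_mul_ofPath_comp, Quiver.Path.nil_comp]
      rfl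
    · intro z _ hz
      exact ofPath_mul_ofPath_ne _ _ hz.symm
    · simp
  exact congrArg (fun T => T f) h

theorem mul_one' [Fintype V] (f : PathAlgebra k V) : f * 1 = f := by
  have h : (mulHom (k := k) (V := V)).flip 1 = LinearMap.id := by
    refine lhom_ext fun x y p => ?_
    rw [LinearMap.flip_apply, one_def, map_sum, Finset.sum_eq_single y]
    · change ofPath p * ofPath _ = _
      rw [ofPath_mul_ofPath_comp, Quiver.Path.comp_nil]
      rfl
    · intro z _ hz
      exact ofPath_mul_ofPath_ne _ _ hz
    · simp
  exact congrArg (fun T => T f) h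

instance [Fintype V] : Ring (PathAlgebra k V) :=
  { (inferInstance : AddCommGroup (PathAlgebra k V)) with
    mul := (· * ·)
    one := 1
    mul_assoc := mul_assoc'
    one_mul := one_mul'
    mul_one := mul_one'
    zero_mul := fun f => by rw [mul_def, map_zero, LinearMap.zero_apply]
    mul_zero := fun f => by rw [mul_def, map_zero]
    left_distrib := fun f g h => by simp only [mul_def, map_add]
    right_distrib := fun f g h => by simp only [mul_def, map_add, LinearMap.add_apply] }

instance [Fintype V] : Algebra k (PathAlgebra k V) :=
  Algebra.ofModule
    (fun r f g => by
      change mulHom (r • f) g = r • mulHom f g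
      rw [map_smul, LinearMap.smul_apply])
    (fun r f g => by
      change mulHom f (r • g) = r • mulHom f g
      rw [map_smul])

/-- The linear map `kQ' → kQ` induced by a morphism of quivers `Q' → Q`. -/
def map (k : Type*) [Field k] {V W : Type*} [Quiver V] [Quiver W] (F : V ⥤q W) :
    PathAlgebra k V →ₗ[k] PathAlgebra k W :=
  Finsupp.lmapDomain k k fun p : TotalPath V => ⟨F.obj p.src, F.obj p.tgt, F.mapPath p.path⟩

/-- The identification of linear combinations of paths from `x` to `y` with elements of
`e_x (kQ) e_y`. -/
def ofParallel (k : Type*) [Field k] {V : Type*} [Quiver V] (x y : V) :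
    (Quiver.Path x y →₀ k) →ₗ[k] PathAlgebra k V :=
  Finsupp.lmapDomain k k fun p => (⟨x, y, p⟩ : TotalPath V)

end PathAlgebra

/-! ### Admissible ideals, presentations, triangular algebras -/

section Presentations

variable (k : Type u) [Field k]

/-- The two-sided ideal generated by a set. -/
def twoSidedSpan {R : Type*} [Ring R] (s : Set R) : Ideal R :=
  TwoSidedIdeal.asIdeal (TwoSidedIdeal.span s)

/-- The two-sided ideal `F` of `kQ` generated by the arrows. -/
def arrowIdeal (V : Type*) [Quiver V] [Fintype V] : Ideal (PathAlgebra k V) :=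
  twoSidedSpan {f | ∃ (x y : V) (α : x ⟶ y), f = PathAlgebra.ofPath α.toPath}

/-- A two-sided ideal `I` is admissible if `F ^ m ⊆ I ⊆ F ^ 2` for some `m ≥ 2`. -/
structure IsAdmissible {V : Type*} [Quiver V] [Fintype V] (I : Ideal (PathAlgebra k V)) :
    Prop where
  isTwoSided : I.IsTwoSided
  exists_pow_le : ∃ m : ℕ, 2 ≤ m ∧ arrowIdeal k V ^ m ≤ I
  le_sq : I ≤ arrowIdeal k V ^ 2

/-- `(Q, I)` is a presentation of the algebra `A`: the ideal `I` is admissible and it is the kernel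
of a surjective morphism of algebras `kQ → A`. -/
def IsPresentation (Q : FinConnQuiver) (I : Ideal (PathAlgebra k Q.Vert))
    (A : Type*) [Ring A] [Algebra k A] : Prop :=
  IsAdmissible k I ∧
    ∃ ν : PathAlgebra k Q.Vert →ₐ[k] A, Function.Surjective ν ∧ RingHom.ker ν = I

/-- `A` is a triangular algebra: it is presented by a finite connected quiver without oriented
cycles. (The quiver in a presentation of `A` is determined by `A` up to isomorphism.) -/
def IsTriangularAlgebra (A : Type*) [Ring A] [Algebra k A] : Prop :=
  ∃ (Q : FinConnQuiver) (I : Ideal (PathAlgebra k Q.Vert)),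
    IsAcyclic Q.Vert ∧ IsPresentation k Q I A

end Presentations

/-! ### Homotopy of walks and the fundamental group -/

section Homotopy

variable {k : Type*} [Field k] {V : Type*} [Quiver V] [Fintype V]

/-- The linear combination `ρ = ∑ λ_i w_i` of pairwise distinct paths `w_i : x → y` with nonzero
coefficients (the support of `ρ` is the set of the `w_i`) is a minimal relation of `I`: it lies in
`I`, it has at least two terms, and no nonempty proper partial sum lies in `I`. -/
structure IsMinimalRelation (I : Ideal (PathAlgebra k V)) {x y : V}
    (ρ : Quiver.Path x y →₀ k) : Prop where
  mem : PathAlgebra.ofParallel k x y ρ ∈ I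
  two_le : 2 ≤ ρ.support.card
  partial_notMem : ∀ T : Finset (Quiver.Path x y), T.Nonempty → T ⊂ ρ.support →
    PathAlgebra.ofParallel k x y (∑ p ∈ T, Finsupp.single p (ρ p)) ∉ I

/-- Walks from `x` to `y`: compositions of arrows and formal inverses of arrows. -/
abbrev Walk {V : Type*} [Quiver V] (x y : Quiver.Symmetrify V) : Type _ :=
  Quiver.Path x y

/-- A path regarded as a walk. -/
def toWalk {V : Type*} [Quiver V] {x y : V} (p : Quiver.Path x y) :
    Walk (Quiver.Symmetrify.of.obj x) (Quiver.Symmetrify.of.obj y) :=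
  Quiver.Symmetrify.of.mapPath p

/-- An arrow regarded as a walk. -/
def arrowWalk {V : Type*} [Quiver V] {x y : V} (α : x ⟶ y) :
    Walk (Quiver.Symmetrify.of.obj x) (Quiver.Symmetrify.of.obj y) :=
  (Quiver.Symmetrify.of.map α).toPath

/-- The formal inverse of an arrow regarded as a walk. -/
def invArrowWalk {V : Type*} [Quiver V] {x y : V} (α : x ⟶ y) :
    Walk (Quiver.Symmetrify.of.obj y) (Quiver.Symmetrify.of.obj x) :=
  (Quiver.reverse (Quiver.Symmetrify.of.map α)).toPath

/-- The homotopy relation of `(Q, I)`: the smallest equivalence relation on walks that cancels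
`α α⁻¹` and `α⁻¹ α`, identifies the paths of each minimal relation, and is compatible with
composition. -/
inductive Homotopic (I : Ideal (PathAlgebra k V)) :
    ∀ {x y : Quiver.Symmetrify V}, Walk x y → Walk x y → Prop
  | refl {x y : Quiver.Symmetrify V} (p : Walk x y) : Homotopic I p p
  | symm {x y : Quiver.Symmetrify V} {p q : Walk x y} : Homotopic I p q → Homotopic I q p
  | trans {x y : Quiver.Symmetrify V} {p q r : Walk x y} :
      Homotopic I p q → Homotopic I q r → Homotopic I p r
  | arrow_inv {x y : V} (α : x ⟶ y) :
      Homotopic I ((arrowWalk α).comp (invArrowWalk α)) Quiver.Path.nil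
  | inv_arrow {x y : V} (α : x ⟶ y) :
      Homotopic I ((invArrowWalk α).comp (arrowWalk α)) Quiver.Path.nil
  | minimal {x y : V} (ρ : Quiver.Path x y →₀ k) (hρ : IsMinimalRelation I ρ)
      (p q : Quiver.Path x y) (hp : p ∈ ρ.support) (hq : q ∈ ρ.support) :
      Homotopic I (toWalk p) (toWalk q)
  | comp {x y z t : Quiver.Symmetrify V} (p : Walk x y) {q r : Walk y z} (s : Walk z t) :
      Homotopic I q r → Homotopic I ((p.comp q).comp s) ((p.comp r).comp s)

variable {x y z : Quiver.Symmetrify V}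

theorem Homotopic.comp_both {I : Ideal (PathAlgebra k V)} {p p' : Walk x y}
    {q q' : Walk y z} (hp : Homotopic I p p') (hq : Homotopic I q q') :
    Homotopic I (p.comp q) (p'.comp q') := by
  have h1 := Homotopic.comp (Quiver.Path.nil : Walk x x) q hp
  have h2 := Homotopic.comp p' (Quiver.Path.nil : Walk z z) hq
  rw [Quiver.Path.nil_comp, Quiver.Path.nil_comp] at h1
  exact h1.trans h2

theorem Homotopic.edge_inv (I : Ideal (PathAlgebra k V)) (e : x ⟶ y) :
    Homotopic I (e.toPath.comp (Quiver.reverse e).toPath) Quiver.Path.nil := by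
  rcases e with α | α
  · exact Homotopic.arrow_inv α
  · exact Homotopic.inv_arrow α

theorem Homotopic.comp_reverse (I : Ideal (PathAlgebra k V)) (p : Walk x y) :
    Homotopic I (p.comp p.reverse) Quiver.Path.nil := by
  induction p with
  | nil => exact Homotopic.refl _
  | cons p e ih =>
    have h3 := Homotopic.comp p p.reverse (Homotopic.edge_inv I e)
    rw [Quiver.Path.comp_nil] at h3
    have h4 : (p.cons e).comp (p.cons e).reverse =
        (p.comp (e.toPath.comp (Quiver.reverse e).toPath)).comp p.reverse := by
      rw [Quiver.Path.reverse, ← Quiver.Path.comp_assoc, ← Quiver.Path.comp_assoc]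
      rfl
    rw [h4]
    exact h3.trans ih

theorem Homotopic.reverse_comp (I : Ideal (PathAlgebra k V)) (p : Walk x y) :
    Homotopic I (p.reverse.comp p) Quiver.Path.nil := by
  have h := Homotopic.comp_reverse I p.reverse
  rwa [Quiver.Path.reverse_reverse] at h

theorem Homotopic.reverse_congr {I : Ideal (PathAlgebra k V)} {p q : Walk x y}
    (h : Homotopic I p q) : Homotopic I p.reverse q.reverse := by
  have h1 := Homotopic.comp p.reverse q.reverse h
  have h2 := (Homotopic.reverse_comp I p).comp_both (Homotopic.refl (I := I) q.reverse)
  have h3 := (Homotopic.refl (I := I) p.reverse).comp_both (Homotopic.comp_reverse I q)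
  rw [Quiver.Path.nil_comp] at h2
  rw [Quiver.Path.comp_nil, ← Quiver.Path.comp_assoc] at h3
  exact (h3.symm.trans h1.symm).trans h2

/-- Homotopy as an equivalence relation on the closed walks at `v₀`. -/
def homotopySetoid (I : Ideal (PathAlgebra k V)) (v₀ : V) :
    Setoid (Walk (Quiver.Symmetrify.of.obj v₀) (Quiver.Symmetrify.of.obj v₀)) where
  r p q := Homotopic I p q
  iseqv := ⟨Homotopic.refl, Homotopic.symm, Homotopic.trans⟩

/-- The fundamental group `π₁(Q, I, v₀)`: closed walks at `v₀` up to homotopy. -/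
def FundamentalGroup (I : Ideal (PathAlgebra k V)) (v₀ : V) : Type _ :=
  Quotient (homotopySetoid I v₀)

/-- The product is induced by the composition of walks. -/
instance (I : Ideal (PathAlgebra k V)) (v₀ : V) : Group (FundamentalGroup I v₀) where
  mul := Quotient.map₂ (fun p q => p.comp q) fun _ _ hp _ _ hq => hp.comp_both hq
  one := Quotient.mk _ Quiver.Path.nil
  inv := Quotient.map (fun p => p.reverse) fun _ _ h => h.reverse_congr
  mul_assoc := by
    rintro ⟨p⟩ ⟨q⟩ ⟨r⟩
    exact congrArg (Quotient.mk _) (Quiver.Path.comp_assoc p q r)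
  one_mul := by
    rintro ⟨p⟩
    exact congrArg (Quotient.mk _) (Quiver.Path.nil_comp p)
  mul_one := by
    rintro ⟨p⟩
    rfl
  inv_mul_cancel := by
    rintro ⟨p⟩
    exact Quotient.sound (Homotopic.reverse_comp I p)

end Homotopy

/-! ### Coproducts of pointed bound quivers -/

section Coproduct

/-- `ι₁` and `ι₂` exhibit `Q` as the quiver obtained from the disjoint union of `Q₁` and `Q₂` by
identifying the vertex `v₁` of `Q₁` with the vertex `v₂` of `Q₂`. -/
structure IsWedge {V₁ V₂ V : Type*} [Quiver V₁] [Quiver V₂] [Quiver V]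
    (ι₁ : V₁ ⥤q V) (ι₂ : V₂ ⥤q V) (v₁ : V₁) (v₂ : V₂) : Prop where
  injective_left : Function.Injective ι₁.obj
  injective_right : Function.Injective ι₂.obj
  obj_eq_iff : ∀ x y, ι₁.obj x = ι₂.obj y ↔ x = v₁ ∧ y = v₂
  obj_surjective : ∀ z, (∃ x, ι₁.obj x = z) ∨ ∃ y, ι₂.obj y = z
  arrow_bijective : Function.Bijective
    (Sum.elim (fun α => ⟨ι₁.obj α.1, ι₁.obj α.2.1, ι₁.map α.2.2⟩)
        (fun α => ⟨ι₂.obj α.1, ι₂.obj α.2.1, ι₂.map α.2.2⟩) :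
      (Σ x y : V₁, x ⟶ y) ⊕ (Σ x y : V₂, x ⟶ y) → Σ x y : V, x ⟶ y)

/-- The ideal `I₁ + I₂` of the coproduct: the two-sided ideal of `kQ` generated by the images of
`I₁` and `I₂`. -/
def coproductIdeal {k : Type*} [Field k] {V₁ V₂ V : Type*} [Quiver V₁] [Quiver V₂] [Quiver V]
    [Fintype V₁] [Fintype V₂] [Fintype V] (ι₁ : V₁ ⥤q V) (ι₂ : V₂ ⥤q V)
    (I₁ : Ideal (PathAlgebra k V₁)) (I₂ : Ideal (PathAlgebra k V₂)) : Ideal (PathAlgebra k V) :=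
  twoSidedSpan (PathAlgebra.map k ι₁ '' I₁ ∪ PathAlgebra.map k ι₂ '' I₂)

end Coproduct

/-! ### Groups -/

/-- `H` has a finite presentation `⟨x_1, …, x_n | R⟩` without free generators: every generator
occurs in (the reduced word of) some relator. -/
def HasPresentationWithoutFreeGenerators (H : Type*) [Group H] : Prop :=
  ∃ (n : ℕ) (R : Set (FreeGroup (Fin n))), R.Finite ∧
    (∀ i : Fin n, ∃ r ∈ R, ∃ b : Bool, (i, b) ∈ r.toWord) ∧ Nonempty (PresentedGroup R ≃* H)

/-- `A` is a triangular algebra with the two presentations `(Q, J)` and `(Q, J')`, whose quiver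
has no oriented cycles, such that `π₁(Q, J) ≅ G` and `π₁(Q, J')` is trivial (for every choice of
the base point). -/
structure IsTwinPresentation (k : Type*) [Field k] (Q : FinConnQuiver)
    (J J' : Ideal (PathAlgebra k Q.Vert)) (A : Type*) [Ring A] [Algebra k A]
    (G : Type*) [Group G] : Prop where
  triangular : IsTriangularAlgebra k A
  acyclic : IsAcyclic Q.Vert
  presentation : IsPresentation k Q J A
  presentation' : IsPresentation k Q J' A
  fundamentalGroup : ∀ v₀ : Q.Vert, Nonempty (FundamentalGroup J v₀ ≃* G)
  fundamentalGroup' : ∀ v₀ : Q.Vert, Subsingleton (FundamentalGroup J' v₀)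

end BoundQuiver

end

/-!
The quivers are stars: on each ray two layers of arrows lead from the center through a middle vertex
to an outer vertex, so that all paths have length at most two. The ideals are given by partial
labellings of the paths of length two: an unlabelled path is zero, and two parallel paths with the
same label are equal. A homotopy-invariant weight of the arrows in a group is then a pair of weight
functions on the two layers for which paths with the same label have the same weight, and the
fundamental group is the target of the universal such pair. Taking the generators as arrows of the
first layer and the suffixes of the relators as arrows of the second one, the labels can express
that consecutive suffixes differ by a generator and that each relator is trivial; the universal
weights then generate the presented group, and several rays give a free product.

The change of presentation is a transvection: one adds to the arrow of each generator a further,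
parallel arrow, which has trivial weight. Before the change the path from a generator to the base
arrow of the second layer is zero; afterwards it is identified with a path of trivial weight. Hence
all generators, and with them the fundamental group, become trivial.
-/

noncomputable section

namespace BoundQuiver

/-! ### Weights of walks and the fundamental group -/

section WalkWeight

variable {V : Type*} [Quiver V] {G : Type*} [Group G] (val : ∀ {x y : V}, (x ⟶ y) → G)

/-- The weight of an edge of the symmetrified quiver, given weights `val` of the arrows in a
group. -/
def edgeWeight : ∀ {x y : Quiver.Symmetrify V}, (x ⟶ y) → G
  | _, _, Sum.inl α => val α
  | _, _, Sum.inr α => (val α)⁻¹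

/-- The weight of a walk: the product of the weights of its edges. -/
def walkWeight {x : Quiver.Symmetrify V} : ∀ {y : Quiver.Symmetrify V}, Walk x y → G
  | _, Quiver.Path.nil => 1
  | _, Quiver.Path.cons p e => walkWeight p * edgeWeight val e

theorem walkWeight_nil (x : Quiver.Symmetrify V) :
    walkWeight val (Quiver.Path.nil : Walk x x) = 1 := rfl

theorem walkWeight_comp {x y z : Quiver.Symmetrify V} (p : Walk x y) (q : Walk y z) :
    walkWeight val (p.comp q) = walkWeight val p * walkWeight val q := by
  induction q with
  | nil => simp only [Quiver.Path.comp_nil, walkWeight_nil, mul_one]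
  | cons q e ih => simp only [Quiver.Path.comp_cons, walkWeight, ih, mul_assoc]

theorem walkWeight_arrowWalk {x y : V} (α : x ⟶ y) : walkWeight val (arrowWalk α) = val α :=
  one_mul _

theorem walkWeight_invArrowWalk {x y : V} (α : x ⟶ y) :
    walkWeight val (invArrowWalk α) = (val α)⁻¹ :=
  one_mul _

theorem edgeWeight_reverse {x y : Quiver.Symmetrify V} (e : x ⟶ y) :
    edgeWeight val (Quiver.reverse e) = (edgeWeight val e)⁻¹ := by
  rcases e with α | α
  · rfl
  · exact (inv_inv _).symm

theorem walkWeight_reverse {x y : Quiver.Symmetrify V} (p : Walk x y) :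
    walkWeight val p.reverse = (walkWeight val p)⁻¹ := by
  induction p with
  | nil => exact inv_one.symm
  | cons p e ih =>
    rw [Quiver.Path.reverse, walkWeight_comp, ih, walkWeight, mul_inv_rev, ← edgeWeight_reverse]
    exact congrArg (· * _) (one_mul _)

theorem map_walkWeight {H : Type*} [Group H] (φ : G →* H) {x y : Quiver.Symmetrify V}
    (p : Walk x y) : φ (walkWeight val p) = walkWeight (fun α => φ (val α)) p := by
  induction p with
  | nil => exact map_one φ
  | cons p e ih =>
    rw [walkWeight, walkWeight, map_mul, ih]
    rcases e with α | α
    · rfl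
    · exact congrArg _ (map_inv φ _)

theorem walkWeight_one {x y : Quiver.Symmetrify V} (p : Walk x y) :
    walkWeight (fun _ => (1 : G)) p = 1 := by
  induction p with
  | nil => rfl
  | cons p e ih => rcases e with α | α <;> simp only [walkWeight, edgeWeight, ih, inv_one, mul_one]

variable {k : Type*} [Field k] [Fintype V]

/-- The weights of the arrows take the same value on the paths of each minimal relation of `I`, so
that they define a homomorphism on the fundamental group. -/
def RespectsRelations (I : Ideal (PathAlgebra k V)) (val : ∀ {x y : V}, (x ⟶ y) → G) : Prop :=
  ∀ {x y : V} (ρ : Quiver.Path x y →₀ k), IsMinimalRelation I ρ → ∀ p ∈ ρ.support,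
    ∀ q ∈ ρ.support, walkWeight val (toWalk p) = walkWeight val (toWalk q)

variable {I : Ideal (PathAlgebra k V)} {val}

theorem Homotopic.walkWeight_eq (hI : RespectsRelations I val) {x y : Quiver.Symmetrify V}
    {p q : Walk x y} (h : Homotopic I p q) : walkWeight val p = walkWeight val q := by
  induction h with
  | refl => rfl
  | symm _ ih => exact ih.symm
  | trans _ _ ih ih' => exact ih.trans ih'
  | arrow_inv α =>
    rw [walkWeight_comp, walkWeight_arrowWalk, walkWeight_invArrowWalk, mul_inv_cancel,
      walkWeight_nil]
  | inv_arrow α =>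
    rw [walkWeight_comp, walkWeight_arrowWalk, walkWeight_invArrowWalk, inv_mul_cancel,
      walkWeight_nil]
  | minimal ρ hρ p q hp hq => exact hI ρ hρ p hp q hq
  | comp p s _ ih => simp only [walkWeight_comp, ih]

/-- The homomorphism `π₁(Q, I, v₀) → G` given by weights of the arrows. -/
def FundamentalGroup.weightHom (hI : RespectsRelations I val) (v₀ : V) :
    FundamentalGroup I v₀ →* G where
  toFun := Quotient.lift (fun p => walkWeight val p) fun _ _ h => Homotopic.walkWeight_eq hI h
  map_one' := rfl
  map_mul' := by
    rintro ⟨p⟩ ⟨q⟩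
    exact walkWeight_comp val p q

end WalkWeight

section LoopClass

/-- The homotopy class of a closed walk. -/
def FundamentalGroup.mk {k : Type*} [Field k] {V : Type*} [Quiver V] [Fintype V]
    (I : Ideal (PathAlgebra k V)) {v₀ : V}
    (p : Walk (Quiver.Symmetrify.of.obj v₀) (Quiver.Symmetrify.of.obj v₀)) :
    FundamentalGroup I v₀ :=
  Quotient.mk _ p

variable {k : Type*} [Field k] {V : Type*} [Quiver V] [Fintype V] {I : Ideal (PathAlgebra k V)}
  {v₀ : V} {t : ∀ x : Quiver.Symmetrify V, Walk (Quiver.Symmetrify.of.obj v₀) x}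
  {x y z : Quiver.Symmetrify V}

/-- The class in `π₁(Q, I, v₀)` of a walk, closed up by means of a system `t` of walks from `v₀` to
all vertices. -/
def loopClass (I : Ideal (PathAlgebra k V))
    (t : ∀ x : Quiver.Symmetrify V, Walk (Quiver.Symmetrify.of.obj v₀) x) (p : Walk x y) :
    FundamentalGroup I v₀ :=
  .mk I (((t x).comp p).comp (t y).reverse)

theorem loopClass_congr {p q : Walk x y} (h : Homotopic I p q) :
    loopClass I t p = loopClass I t q :=
  Quotient.sound (Homotopic.comp _ _ h)

theorem loopClass_comp (p : Walk x y) (q : Walk y z) :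
    loopClass I t (p.comp q) = loopClass I t p * loopClass I t q := by
  refine (Quotient.sound (show Homotopic I _ _ from ?_)).symm
  have h := Homotopic.comp ((t x).comp p) (q.comp (t z).reverse)
    (Homotopic.reverse_comp I (t y))
  simpa only [Quiver.Path.comp_assoc, Quiver.Path.nil_comp, Quiver.Path.comp_nil] using h

theorem loopClass_nil (x : Quiver.Symmetrify V) :
    loopClass I t (Quiver.Path.nil : Walk x x) = 1 :=
  mul_eq_left.mp (loopClass_comp (I := I) (t := t) (Quiver.Path.nil : Walk x x) .nil).symm

theorem loopClass_eq_one {p : Walk x y} (h : (t x).comp p = t y) : loopClass I t p = 1 := by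
  rw [loopClass, h]
  exact Quotient.sound (Homotopic.comp_reverse I (t y))

theorem loopClass_invArrowWalk {x y : V} (α : x ⟶ y) :
    loopClass I t (invArrowWalk α) = (loopClass I t (arrowWalk α))⁻¹ := by
  rw [eq_inv_iff_mul_eq_one, ← loopClass_comp, loopClass_congr (Homotopic.inv_arrow α),
    loopClass_nil]

theorem walkWeight_loopClass_arrowWalk (p : Walk x y) :
    walkWeight (fun α => loopClass I t (arrowWalk α)) p = loopClass I t p := by
  induction p with
  | nil => exact (loopClass_nil x).symm
  | cons p e ih =>
    rw [walkWeight, ih, ← Quiver.Path.comp_toPath_eq_cons, loopClass_comp]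
    rcases e with α | α
    · rfl
    · exact congrArg _ (loopClass_invArrowWalk α).symm

theorem loopClass_eq_mk (ht : Homotopic I (t (Quiver.Symmetrify.of.obj v₀)) Quiver.Path.nil)
    (p : Walk (Quiver.Symmetrify.of.obj v₀) (Quiver.Symmetrify.of.obj v₀)) :
    loopClass I t p = .mk I p := by
  have h := (ht.comp_both (Homotopic.refl p)).comp_both ht.reverse_congr
  rw [Quiver.Path.nil_comp] at h
  exact Quotient.sound h

theorem subsingleton_fundamentalGroup
    (ht : Homotopic I (t (Quiver.Symmetrify.of.obj v₀)) Quiver.Path.nil)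
    (h : ∀ (x y : V) (α : x ⟶ y), loopClass I t (arrowWalk α) = 1) :
    Subsingleton (FundamentalGroup I v₀) := by
  refine subsingleton_of_forall_eq 1 ?_
  rintro ⟨p⟩
  change FundamentalGroup.mk I p = 1
  rw [← loopClass_eq_mk ht, ← walkWeight_loopClass_arrowWalk]
  simp only [h, walkWeight_one]

theorem weightHom_loopClass {G : Type*} [Group G] {val : ∀ {x y : V}, (x ⟶ y) → G}
    (hI : RespectsRelations I val) (p : Walk x y) :
    FundamentalGroup.weightHom hI v₀ (loopClass I t p) =
      walkWeight val (t x) * walkWeight val p * (walkWeight val (t y))⁻¹ := by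
  rw [← walkWeight_reverse, ← walkWeight_comp, ← walkWeight_comp]
  rfl

theorem nonempty_fundamentalGroup_mulEquiv {G : Type*} [Group G] {val : ∀ {x y : V}, (x ⟶ y) → G}
    (ht : Homotopic I (t (Quiver.Symmetrify.of.obj v₀)) Quiver.Path.nil)
    (hI : RespectsRelations I val) (hval : ∀ x, walkWeight val (t x) = 1)
    (Ψ : G →* FundamentalGroup I v₀)
    (hΨ : ∀ (x y : V) (α : x ⟶ y), Ψ (val α) = loopClass I t (arrowWalk α))
    (hext : ∀ θ : G →* G, (∀ (x y : V) (α : x ⟶ y), θ (val α) = val α) → θ = MonoidHom.id G) :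
    Nonempty (FundamentalGroup I v₀ ≃* G) := by
  refine ⟨MonoidHom.toMulEquiv (FundamentalGroup.weightHom hI v₀) Ψ ?_ (hext _ fun x y α => ?_)⟩
  · refine MonoidHom.ext ?_
    rintro ⟨p⟩
    change Ψ (walkWeight val p) = FundamentalGroup.mk I p
    rw [map_walkWeight, ← loopClass_eq_mk ht, ← walkWeight_loopClass_arrowWalk]
    simp only [hΨ]
  · rw [MonoidHom.comp_apply, hΨ, weightHom_loopClass, hval, hval, walkWeight_arrowWalk, one_mul,
      inv_one, mul_one]

end LoopClass

/-! ### Ideals of path algebras -/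

section TwoSidedSpan

variable {R : Type*} [Ring R] {s : Set R}

theorem subset_twoSidedSpan : s ⊆ twoSidedSpan s :=
  TwoSidedIdeal.subset_span

theorem twoSidedSpan_le {I : Ideal R} [I.IsTwoSided] (h : s ⊆ I) : twoSidedSpan s ≤ I := by
  intro a ha
  have h' : TwoSidedIdeal.span s ≤ I.toTwoSided :=
    TwoSidedIdeal.span_le.mpr fun b hb => Ideal.mem_toTwoSided.mpr (h hb)
  exact Ideal.mem_toTwoSided.mp (h' ha)

end TwoSidedSpan

namespace PathAlgebra

variable {k : Type*} [Field k] {V : Type*} [Quiver V]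

/-- The linear map with prescribed values on the paths. -/
def lift {M : Type*} [AddCommGroup M] [Module k M] (f : TotalPath V → M) :
    PathAlgebra k V →ₗ[k] M :=
  Finsupp.linearCombination k f

theorem lift_ofPath {M : Type*} [AddCommGroup M] [Module k M] (f : TotalPath V → M) {x y : V}
    (p : Quiver.Path x y) : lift f (ofPath p : PathAlgebra k V) = f ⟨x, y, p⟩ :=
  (Finsupp.linearCombination_single k (1 : k) _).trans (one_smul k _)

theorem map_ofPath {W : Type*} [Quiver W] (F : V ⥤q W) {x y : V} (p : Quiver.Path x y) :
    map k F (ofPath p) = ofPath (F.mapPath p) :=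
  Finsupp.mapDomain_single

theorem ofParallel_single {x y : V} (p : Quiver.Path x y) (c : k) :
    ofParallel k x y (Finsupp.single p c) = c • ofPath p := by
  refine Finsupp.mapDomain_single.trans ?_
  refine Eq.trans ?_ (Finsupp.smul_single c _ (1 : k)).symm
  rw [smul_eq_mul, mul_one]

theorem span_ofPath :
    Submodule.span k {f : PathAlgebra k V | ∃ (x y : V) (p : Quiver.Path x y), f = ofPath p} =
      ⊤ := by
  refine eq_top_iff.mpr fun f _ => ?_
  refine Finsupp.induction_linear f (Submodule.zero_mem _) (fun f g => Submodule.add_mem _)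
    fun p c => ?_
  have hc : (Finsupp.single p c : TotalPath V →₀ k) = c • Finsupp.single p 1 := by
    rw [Finsupp.smul_single, smul_eq_mul, mul_one]
  rw [hc]
  exact Submodule.smul_mem _ c (Submodule.subset_span ⟨p.src, p.tgt, p.path, rfl⟩)

theorem ofPath_cons {x y z : V} (p : Quiver.Path x y) (α : y ⟶ z) :
    (ofPath (p.cons α) : PathAlgebra k V) = ofPath p * ofPath α.toPath :=
  (ofPath_mul_ofPath_comp p α.toPath).symm

section Morphisms

variable [Fintype V]

theorem completeOrthogonalIdempotents_ofPath_nil :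
    CompleteOrthogonalIdempotents
      fun x : V => (ofPath (Quiver.Path.nil : Quiver.Path x x) : PathAlgebra k V) where
  idem _ := ofPath_mul_ofPath_comp _ _
  ortho _ _ h := ofPath_mul_ofPath_ne _ _ h.symm
  complete := rfl

theorem algHom_ext {R : Type*} [Ring R] [Algebra k R] {φ ψ : PathAlgebra k V →ₐ[k] R}
    (hnil : ∀ x : V, φ (ofPath (Quiver.Path.nil : Quiver.Path x x)) =
      ψ (ofPath (Quiver.Path.nil : Quiver.Path x x)))
    (harrow : ∀ (x y : V) (α : x ⟶ y), φ (ofPath α.toPath) = ψ (ofPath α.toPath)) : φ = ψ := by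
  refine AlgHom.toLinearMap_injective (lhom_ext fun x y p => ?_)
  change φ (ofPath p) = ψ (ofPath p)
  induction p with
  | nil => exact hnil x
  | cons p α ih => rw [ofPath_cons, map_mul, map_mul, ih, harrow]

end Morphisms

section Substitution

variable {R : Type*} [Ring R] [Algebra k R] (e : V → R) (E : ∀ {x y : V}, (x ⟶ y) → R)

/-- The image of a path when the stationary path at `x` is replaced by `e x` and the arrow
`α : x ⟶ y` by `e x * E α * e y`. -/
def substPath {x : V} : ∀ {y : V}, Quiver.Path x y → R
  | _, Quiver.Path.nil => e x
  | _, Quiver.Path.cons (c := z) p α => substPath p * (E α * e z)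

variable {e}

theorem substPath_mul_right (he : OrthogonalIdempotents e) {x y : V} (p : Quiver.Path x y) :
    substPath e E p * e y = substPath e E p := by
  cases p with
  | nil => exact he.idem x
  | cons p α => rw [substPath, mul_assoc, mul_assoc, he.idem y]

theorem substPath_mul_left (he : OrthogonalIdempotents e) {x y : V} (p : Quiver.Path x y) :
    e x * substPath e E p = substPath e E p := by
  induction p with
  | nil => exact he.idem x
  | cons p α ih => rw [substPath, ← mul_assoc, ih]

theorem substPath_comp (he : OrthogonalIdempotents e) {x y z : V} (p : Quiver.Path x y)
    (q : Quiver.Path y z) : substPath e E (p.comp q) = substPath e E p * substPath e E q := by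
  induction q with
  | nil => exact (substPath_mul_right E he p).symm
  | cons q α ih => rw [Quiver.Path.comp_cons, substPath, substPath, ih, mul_assoc]

theorem substPath_mul_of_ne (he : OrthogonalIdempotents e) {x y x' y' : V} (p : Quiver.Path x y)
    (q : Quiver.Path x' y') (h : x' ≠ y) : substPath e E p * substPath e E q = 0 := by
  rw [← substPath_mul_right E he p, ← substPath_mul_left E he q, mul_assoc, ← mul_assoc (e y),
    he.ortho h.symm, zero_mul, mul_zero]

/-- The morphism of algebras that replaces the stationary path at `x` by `e x` and the arrow
`α : x ⟶ y` by `e x * E α * e y`. -/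
def substHom [Fintype V] (he : CompleteOrthogonalIdempotents e) : PathAlgebra k V →ₐ[k] R :=
  AlgHom.ofLinearMap (lift fun p : TotalPath V => substPath e E p.path)
    (by
      rw [one_def, map_sum, ← he.complete]
      exact Finset.sum_congr rfl fun x _ => lift_ofPath (k := k) _ Quiver.Path.nil)
    (by
      set φ : PathAlgebra k V →ₗ[k] R := lift fun p : TotalPath V => substPath e E p.path
      have h : (mulHom (k := k) (V := V)).compr₂ φ = (LinearMap.mul k R).compl₁₂ φ φ := by
        refine lhom_ext fun x y p => lhom_ext fun x' y' q => ?_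
        change φ (ofPath p * ofPath q) = φ (ofPath p) * φ (ofPath q)
        rw [lift_ofPath, lift_ofPath]
        rcases eq_or_ne x' y with rfl | hxy
        · rw [ofPath_mul_ofPath_comp, lift_ofPath]
          exact substPath_comp E he.toOrthogonalIdempotents p q
        · rw [ofPath_mul_ofPath_ne _ _ hxy, map_zero]
          exact (substPath_mul_of_ne E he.toOrthogonalIdempotents p q hxy).symm
      exact fun f g => congrArg (fun T => T f g) h)

variable [Fintype V] (he : CompleteOrthogonalIdempotents e)

theorem substHom_nil (x : V) :
    substHom (k := k) E he (ofPath (Quiver.Path.nil : Quiver.Path x x)) = e x :=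
  lift_ofPath _ _

theorem substHom_arrow {x y : V} (α : x ⟶ y) :
    substHom (k := k) E he (ofPath α.toPath) = e x * (E α * e y) :=
  lift_ofPath _ _

end Substitution

section SpanIdeal

variable {s : Set (PathAlgebra k V)}

/-- The products of an element of `s` with a path, on either side, lie in the span of `s`. This is
what makes the span of `s` a two-sided ideal. -/
def IsPathStable (s : Set (PathAlgebra k V)) : Prop :=
  ∀ f ∈ s, ∀ {x y : V} (p : Quiver.Path x y),
    ofPath p * f ∈ Submodule.span k s ∧ f * ofPath p ∈ Submodule.span k s

variable [Fintype V]

theorem IsPathStable.mul_mem_left (hs : IsPathStable s) (g : PathAlgebra k V)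
    {f : PathAlgebra k V} (hf : f ∈ Submodule.span k s) : g * f ∈ Submodule.span k s := by
  have h := Submodule.mul_mem_mul (span_ofPath (k := k) (V := V) ▸ Submodule.mem_top (x := g)) hf
  rw [Submodule.span_mul_span] at h
  refine Submodule.span_le.mpr ?_ h
  rintro _ ⟨_, ⟨x, y, p, rfl⟩, f, hf, rfl⟩
  exact (hs f hf p).1

theorem IsPathStable.mul_mem_right (hs : IsPathStable s) (g : PathAlgebra k V)
    {f : PathAlgebra k V} (hf : f ∈ Submodule.span k s) : f * g ∈ Submodule.span k s := by
  have h := Submodule.mul_mem_mul hf (span_ofPath (k := k) (V := V) ▸ Submodule.mem_top (x := g))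
  rw [Submodule.span_mul_span] at h
  refine Submodule.span_le.mpr ?_ h
  rintro _ ⟨f, hf, _, ⟨x, y, p, rfl⟩, rfl⟩
  exact (hs f hf p).2

/-- The two-sided ideal formed by the linear combinations of elements of `s`. -/
def spanIdeal (s : Set (PathAlgebra k V)) (hs : IsPathStable s) : Ideal (PathAlgebra k V) where
  toAddSubmonoid := (Submodule.span k s).toAddSubmonoid
  smul_mem' g _ hf := hs.mul_mem_left g hf

theorem mem_spanIdeal {hs : IsPathStable s} {f : PathAlgebra k V} :
    f ∈ spanIdeal s hs ↔ f ∈ Submodule.span k s :=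
  Iff.rfl

instance isTwoSided_spanIdeal {hs : IsPathStable s} : (spanIdeal s hs).IsTwoSided :=
  ⟨fun g hf => hs.mul_mem_right g hf⟩

theorem subset_spanIdeal {hs : IsPathStable s} : s ⊆ spanIdeal s hs :=
  Submodule.subset_span

theorem spanIdeal_le {hs : IsPathStable s} {I : Ideal (PathAlgebra k V)} (h : s ⊆ I) :
    spanIdeal s hs ≤ I :=
  Submodule.span_le (p := I.restrictScalars k).mpr h

end SpanIdeal

section LongPaths

/-- The paths of length at least `n`, as elements of the path algebra. -/
def longPaths (k : Type*) [Field k] (V : Type*) [Quiver V] (n : ℕ) : Set (PathAlgebra k V) :=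
  {f | ∃ (x y : V) (p : Quiver.Path x y), n ≤ p.length ∧ f = ofPath p}

theorem ofPath_mul_ofPath_mem_span_longPaths {m n : ℕ} {x y x' y' : V} {p : Quiver.Path x y}
    {q : Quiver.Path x' y'} (hp : m ≤ p.length) (hq : n ≤ q.length) :
    (ofPath p * ofPath q : PathAlgebra k V) ∈ Submodule.span k (longPaths k V (m + n)) := by
  rcases eq_or_ne x' y with rfl | hxy
  · rw [ofPath_mul_ofPath_comp]
    exact Submodule.subset_span
      ⟨x, y', p.comp q, (add_le_add hp hq).trans_eq (Quiver.Path.length_comp p q).symm, rfl⟩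
  · rw [ofPath_mul_ofPath_ne _ _ hxy]
    exact Submodule.zero_mem _

theorem isPathStable_longPaths (n : ℕ) : IsPathStable (longPaths k V n) := by
  rintro _ ⟨x, y, p, hp, rfl⟩ x' y' q
  have hq : 0 ≤ q.length := Nat.zero_le _
  constructor
  · simpa only [zero_add] using ofPath_mul_ofPath_mem_span_longPaths (k := k) hq hp
  · simpa only [add_zero] using ofPath_mul_ofPath_mem_span_longPaths (k := k) hp hq

variable [Fintype V]

/-- The ideal spanned by the paths of length at least `n`; it is the `n`-th power of the arrow
ideal. -/
def longPathIdeal (k : Type*) [Field k] (V : Type*) [Quiver V] [Fintype V] (n : ℕ) :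
    Ideal (PathAlgebra k V) :=
  spanIdeal (longPaths k V n) (isPathStable_longPaths n)

instance isTwoSided_longPathIdeal (n : ℕ) : (longPathIdeal k V n).IsTwoSided :=
  isTwoSided_spanIdeal

theorem ofPath_mem_longPathIdeal {n : ℕ} {x y : V} {p : Quiver.Path x y} (h : n ≤ p.length) :
    ofPath p ∈ longPathIdeal k V n :=
  subset_spanIdeal ⟨x, y, p, h, rfl⟩

theorem longPathIdeal_mul_le (m n : ℕ) :
    longPathIdeal k V m * longPathIdeal k V n ≤ longPathIdeal k V (m + n) := by
  refine Ideal.mul_le.mpr fun f hf g hg => ?_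
  have h := Submodule.mul_mem_mul (mem_spanIdeal.mp hf) (mem_spanIdeal.mp hg)
  rw [Submodule.span_mul_span] at h
  refine mem_spanIdeal.mpr (Submodule.span_le.mpr ?_ h)
  rintro _ ⟨_, ⟨x, y, p, hp, rfl⟩, _, ⟨x', y', q, hq, rfl⟩, rfl⟩
  exact ofPath_mul_ofPath_mem_span_longPaths hp hq

theorem arrowIdeal_le_longPathIdeal : arrowIdeal k V ≤ longPathIdeal k V 1 := by
  refine twoSidedSpan_le ?_
  rintro _ ⟨x, y, α, rfl⟩
  exact ofPath_mem_longPathIdeal (p := α.toPath) le_rfl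

theorem ofPath_mem_arrowIdeal_pow {x y : V} (p : Quiver.Path x y) :
    ofPath p ∈ arrowIdeal k V ^ p.length := by
  induction p with
  | nil => exact (Submodule.pow_zero (arrowIdeal k V)).trans Ideal.one_eq_top ▸ Submodule.mem_top
  | cons p α ih =>
    rw [Quiver.Path.length_cons, Submodule.pow_succ, ofPath_cons]
    exact Ideal.mul_mem_mul ih (subset_twoSidedSpan ⟨_, _, α, rfl⟩)

theorem arrowIdeal_pow (n : ℕ) : arrowIdeal k V ^ n = longPathIdeal k V n := by
  apply le_antisymm
  · induction n with
    | zero =>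
      refine fun f _ => mem_spanIdeal.mpr ?_
      simp only [longPaths, Nat.zero_le, true_and, span_ofPath, Submodule.mem_top]
    | succ n ih =>
      rw [Submodule.pow_succ]
      exact (Ideal.mul_mono ih arrowIdeal_le_longPathIdeal).trans (longPathIdeal_mul_le n 1)
  · refine spanIdeal_le ?_
    rintro _ ⟨x, y, p, hp, rfl⟩
    exact Ideal.pow_le_pow_right hp (ofPath_mem_arrowIdeal_pow p)

end LongPaths

end PathAlgebra

/-! ### Minimal relations -/

section MinimalRelation

variable {k : Type*} [Field k] {V : Type*} [Quiver V] [Fintype V] {I : Ideal (PathAlgebra k V)}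
  {x y : V}

theorem IsMinimalRelation.ofPath_notMem {ρ : Quiver.Path x y →₀ k} (hρ : IsMinimalRelation I ρ)
    {p : Quiver.Path x y} (hp : p ∈ ρ.support) : PathAlgebra.ofPath p ∉ I := by
  intro hmem
  refine hρ.partial_notMem {p} (Finset.singleton_nonempty p) ?_ ?_
  · refine Finset.ssubset_iff_subset_ne.mpr ⟨Finset.singleton_subset_iff.mpr hp, fun h => ?_⟩
    have hcard := hρ.two_le
    rw [← h, Finset.card_singleton] at hcard
    omega
  · rw [Finset.sum_singleton, PathAlgebra.ofParallel_single]
    exact Submodule.smul_of_tower_mem I _ hmem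

theorem isMinimalRelation_single_sub_single {p q : Quiver.Path x y} (hpq : p ≠ q)
    (hp : PathAlgebra.ofPath p ∉ I) (hq : PathAlgebra.ofPath q ∉ I)
    (hsub : (PathAlgebra.ofPath p - PathAlgebra.ofPath q : PathAlgebra k V) ∈ I) :
    IsMinimalRelation I (Finsupp.single p 1 - Finsupp.single q 1) := by
  classical
  have hsupp : (Finsupp.single p 1 - Finsupp.single q 1 : Quiver.Path x y →₀ k).support =
      {p, q} := by
    rw [sub_eq_add_neg, ← Finsupp.single_neg, Finsupp.support_add_eq,
      Finsupp.support_single _ one_ne_zero,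
      Finsupp.support_single _ (neg_ne_zero.mpr one_ne_zero)]
    · rfl
    · rw [Finsupp.support_single _ one_ne_zero,
        Finsupp.support_single _ (neg_ne_zero.mpr one_ne_zero)]
      exact Finset.disjoint_singleton.mpr hpq
  refine ⟨?_, by rw [hsupp, Finset.card_pair hpq], fun T hT hTs hmem => ?_⟩
  · rwa [map_sub, PathAlgebra.ofParallel_single, PathAlgebra.ofParallel_single, one_smul, one_smul]
  · rw [hsupp] at hTs
    obtain ⟨r, rfl⟩ : ∃ r, T = {r} := Finset.card_eq_one.mp <| le_antisymm
      (Nat.lt_succ_iff.mp ((Finset.card_lt_card hTs).trans_eq (Finset.card_pair hpq)))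
      (Finset.card_pos.mpr hT)
    rw [Finset.sum_singleton, PathAlgebra.ofParallel_single] at hmem
    rcases Finset.mem_insert.mp (hTs.1 (Finset.mem_singleton_self r)) with rfl | hr
    · exact hp (by simpa [hpq] using hmem)
    · obtain rfl := Finset.mem_singleton.mp hr
      exact hq (by simpa [hpq] using hmem)

end MinimalRelation

/-! ### Ideals given by labellings of the paths -/

/-- A labelling of the paths by elements of `X`, in which some paths (those with label `none`) may
be left without label. It describes the relations that kill the paths without label and identify
the parallel paths with equal labels; the two axioms say that these relations are stable under
composition. -/
structure PathLabelling (V : Type*) [Quiver V] (X : Type*) where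
  label {x y : V} : Quiver.Path x y → Option X
  label_comp_eq_none {x y z t : V} (r : Quiver.Path x y) {p : Quiver.Path y z}
    (s : Quiver.Path z t) : label p = none → label ((r.comp p).comp s) = none
  label_comp_congr {x y z t : V} (r : Quiver.Path x y) {p q : Quiver.Path y z}
    (s : Quiver.Path z t) :
    label p = label q → label ((r.comp p).comp s) = label ((r.comp q).comp s)

namespace PathLabelling

open PathAlgebra (ofPath ofParallel)

variable {V : Type*} [Quiver V] {X : Type*} (ℓ : PathLabelling V X) (k : Type*) [Field k]

/-- The relations described by a labelling. -/
def relations : Set (PathAlgebra k V) :=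
  {f | ∃ (x y : V) (p : Quiver.Path x y), ℓ.label p = none ∧ f = ofPath p} ∪
    {f | ∃ (x y : V) (p q : Quiver.Path x y), ℓ.label p = ℓ.label q ∧ f = ofPath p - ofPath q}

variable {ℓ k} in
theorem ofPath_mem_relations {x y : V} {p : Quiver.Path x y} (h : ℓ.label p = none) :
    ofPath p ∈ ℓ.relations k :=
  Or.inl ⟨x, y, p, h, rfl⟩

variable {ℓ k} in
theorem ofPath_sub_ofPath_mem_relations {x y : V} {p q : Quiver.Path x y}
    (h : ℓ.label p = ℓ.label q) : ofPath p - ofPath q ∈ ℓ.relations k :=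
  Or.inr ⟨x, y, p, q, h, rfl⟩

/-- The linear map that sends a path to its label, and the paths without label to `0`. The end
points of the path are kept, since only parallel paths are to be identified. -/
def labelMap : PathAlgebra k V →ₗ[k] (V × V × X →₀ k) :=
  PathAlgebra.lift fun p =>
    (ℓ.label p.path).elim 0 fun ξ => Finsupp.single (p.src, p.tgt, ξ) 1

variable {k}

theorem labelMap_ofPath {x y : V} (p : Quiver.Path x y) :
    ℓ.labelMap k (ofPath p) = (ℓ.label p).elim 0 fun ξ => Finsupp.single (x, y, ξ) 1 :=
  PathAlgebra.lift_ofPath _ _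

variable {ℓ}

theorem labelMap_ofPath_of_eq_some {x y : V} {p : Quiver.Path x y} {ξ : X}
    (h : ℓ.label p = some ξ) : ℓ.labelMap k (ofPath p) = Finsupp.single (x, y, ξ) 1 := by
  rw [labelMap_ofPath, h]
  rfl

theorem labelMap_ofPath_of_eq_none {x y : V} {p : Quiver.Path x y} (h : ℓ.label p = none) :
    ℓ.labelMap k (ofPath p) = 0 := by
  rw [labelMap_ofPath, h]
  rfl

theorem labelMap_ofParallel_filter {x y : V} (ρ : Quiver.Path x y →₀ k) (ξ : X) :
    open Classical in
    ℓ.labelMap k (ofParallel k x y (ρ.filter fun p => ℓ.label p = some ξ)) =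
      Finsupp.single (x, y, ξ) (ℓ.labelMap k (ofParallel k x y ρ) (x, y, ξ)) := by
  classical
  induction ρ using Finsupp.induction_linear with
  | zero => simp only [Finsupp.filter_zero, map_zero, Finsupp.zero_apply, Finsupp.single_zero]
  | add ρ ρ' h h' => simp [Finsupp.filter_add, h, h']
  | single p c =>
    by_cases hp : ℓ.label p = some ξ
    · rw [Finsupp.filter_single_of_pos (fun p => ℓ.label p = some ξ) hp,
        PathAlgebra.ofParallel_single, map_smul, labelMap_ofPath_of_eq_some hp]
      simp
    · rw [Finsupp.filter_single_of_neg (fun p => ℓ.label p = some ξ) hp,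
        PathAlgebra.ofParallel_single, map_smul, labelMap_ofPath]
      cases h : ℓ.label p with
      | none => simp
      | some η => simp [show η ≠ ξ by rintro rfl; exact hp h]

theorem labelMap_ofParallel_filter_none {x y : V} (ρ : Quiver.Path x y →₀ k) :
    open Classical in
    ℓ.labelMap k (ofParallel k x y (ρ.filter fun p => ℓ.label p = none)) = 0 := by
  classical
  rw [Finsupp.filter_eq_sum, map_sum, map_sum]
  refine Finset.sum_eq_zero fun p hp => ?_
  rw [PathAlgebra.ofParallel_single, map_smul,
    labelMap_ofPath_of_eq_none (Finset.mem_filter.mp hp).2, smul_zero]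

variable (ℓ k)

theorem ker_labelMap : LinearMap.ker (ℓ.labelMap k) = Submodule.span k (ℓ.relations k) := by
  classical
  apply le_antisymm
  · set π := (Submodule.span k (ℓ.relations k)).mkQ
    let Θ : V × V × X → PathAlgebra k V ⧸ Submodule.span k (ℓ.relations k) := fun ξ =>
      if h : ∃ p : Quiver.Path ξ.1 ξ.2.1, ℓ.label p = some ξ.2.2 then π (ofPath h.choose) else 0
    have hπ : π = Finsupp.linearCombination k Θ ∘ₗ ℓ.labelMap k := by
      refine PathAlgebra.lhom_ext fun x y p => ?_
      rw [LinearMap.comp_apply]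
      cases hp : ℓ.label p with
      | none =>
        rw [labelMap_ofPath_of_eq_none hp, map_zero]
        exact (Submodule.Quotient.mk_eq_zero _).mpr
          (Submodule.subset_span (ofPath_mem_relations hp))
      | some ξ =>
        have h : ∃ q : Quiver.Path x y, ℓ.label q = some ξ := ⟨p, hp⟩
        rw [labelMap_ofPath_of_eq_some hp, Finsupp.linearCombination_single, one_smul]
        refine Eq.trans ?_ (dif_pos h).symm
        exact (Submodule.Quotient.eq _).mpr
          (Submodule.subset_span (ofPath_sub_ofPath_mem_relations (hp.trans h.choose_spec.symm)))
    intro f hf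
    rw [← Submodule.ker_mkQ (Submodule.span k (ℓ.relations k)), LinearMap.mem_ker]
    change π f = 0
    rw [hπ, LinearMap.comp_apply, LinearMap.mem_ker.mp hf, map_zero]
  · rw [Submodule.span_le]
    rintro _ (⟨x, y, p, hp, rfl⟩ | ⟨x, y, p, q, hpq, rfl⟩)
    · exact labelMap_ofPath_of_eq_none hp
    · refine LinearMap.mem_ker.mpr ?_
      rw [map_sub, labelMap_ofPath, labelMap_ofPath, hpq, sub_self]

theorem isPathStable_relations : PathAlgebra.IsPathStable (ℓ.relations k) := by
  rintro _ (⟨x, y, p, hp, rfl⟩ | ⟨x, y, p, q, hpq, rfl⟩) x' y' r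
  · constructor
    · rcases eq_or_ne x y' with rfl | hxy
      · rw [PathAlgebra.ofPath_mul_ofPath_comp]
        exact Submodule.subset_span (ofPath_mem_relations (ℓ.label_comp_eq_none r .nil hp))
      · exact PathAlgebra.ofPath_mul_ofPath_ne (k := k) r p hxy ▸ Submodule.zero_mem _
    · rcases eq_or_ne x' y with rfl | hxy
      · rw [PathAlgebra.ofPath_mul_ofPath_comp, ← Quiver.Path.nil_comp p]
        exact Submodule.subset_span (ofPath_mem_relations (ℓ.label_comp_eq_none .nil r hp))
      · exact PathAlgebra.ofPath_mul_ofPath_ne (k := k) p r hxy ▸ Submodule.zero_mem _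
  · have hmul_sub : (ofPath r * (ofPath p - ofPath q) : PathAlgebra k V) =
        ofPath r * ofPath p - ofPath r * ofPath q :=
      map_sub (PathAlgebra.mulHom (ofPath r)) _ _
    have hsub_mul : ((ofPath p - ofPath q) * ofPath r : PathAlgebra k V) =
        ofPath p * ofPath r - ofPath q * ofPath r :=
      PathAlgebra.mulHom.map_sub₂ _ _ _
    constructor
    · rcases eq_or_ne x y' with rfl | hxy
      · rw [hmul_sub, PathAlgebra.ofPath_mul_ofPath_comp, PathAlgebra.ofPath_mul_ofPath_comp]
        exact Submodule.subset_span
          (ofPath_sub_ofPath_mem_relations (ℓ.label_comp_congr r .nil hpq))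
      · rw [hmul_sub, PathAlgebra.ofPath_mul_ofPath_ne r p hxy,
          PathAlgebra.ofPath_mul_ofPath_ne r q hxy, sub_zero]
        exact Submodule.zero_mem _
    · rcases eq_or_ne x' y with rfl | hxy
      · rw [hsub_mul, PathAlgebra.ofPath_mul_ofPath_comp, PathAlgebra.ofPath_mul_ofPath_comp,
          ← Quiver.Path.nil_comp p, ← Quiver.Path.nil_comp q]
        exact Submodule.subset_span
          (ofPath_sub_ofPath_mem_relations (ℓ.label_comp_congr .nil r hpq))
      · rw [hsub_mul, PathAlgebra.ofPath_mul_ofPath_ne p r hxy,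
          PathAlgebra.ofPath_mul_ofPath_ne q r hxy, sub_zero]
        exact Submodule.zero_mem _

variable [Fintype V]

/-- The ideal of the relations described by a labelling. -/
def labelIdeal : Ideal (PathAlgebra k V) :=
  PathAlgebra.spanIdeal (ℓ.relations k) (ℓ.isPathStable_relations k)

instance isTwoSided_labelIdeal : (ℓ.labelIdeal k).IsTwoSided :=
  PathAlgebra.isTwoSided_spanIdeal

variable {ℓ k}

theorem mem_labelIdeal {f : PathAlgebra k V} : f ∈ ℓ.labelIdeal k ↔ ℓ.labelMap k f = 0 := by
  rw [← LinearMap.mem_ker, ker_labelMap]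
  exact PathAlgebra.mem_spanIdeal

theorem ofPath_mem_labelIdeal {x y : V} {p : Quiver.Path x y} :
    ofPath p ∈ ℓ.labelIdeal k ↔ ℓ.label p = none := by
  rw [mem_labelIdeal, labelMap_ofPath]
  cases ℓ.label p with
  | none => exact iff_of_true rfl rfl
  | some ξ => simp

theorem label_eq_of_isMinimalRelation {x y : V} {ρ : Quiver.Path x y →₀ k}
    (hρ : IsMinimalRelation (ℓ.labelIdeal k) ρ) {p q : Quiver.Path x y} (hp : p ∈ ρ.support)
    (hq : q ∈ ρ.support) : ℓ.label p = ℓ.label q := by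
  classical
  by_contra hpq
  refine hρ.partial_notMem {r ∈ ρ.support | ℓ.label r = ℓ.label p}
    ⟨p, Finset.mem_filter.mpr ⟨hp, rfl⟩⟩ (Finset.filter_ssubset.mpr ⟨q, hq, Ne.symm hpq⟩) ?_
  rw [← Finsupp.filter_eq_sum, mem_labelIdeal]
  cases ℓ.label p with
  | none => exact labelMap_ofParallel_filter_none ρ
  | some ξ =>
    rw [labelMap_ofParallel_filter, mem_labelIdeal.mp hρ.mem, Finsupp.zero_apply,
      Finsupp.single_zero]

theorem respectsRelations {G : Type*} [Group G] {val : ∀ {x y : V}, (x ⟶ y) → G}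
    (h : ∀ {x y : V} {p q : Quiver.Path x y} {ξ : X}, ℓ.label p = some ξ → ℓ.label q = some ξ →
      walkWeight val (toWalk p) = walkWeight val (toWalk q)) :
    RespectsRelations (ℓ.labelIdeal k) val := by
  intro x y ρ hρ p hp q hq
  have hnone := mt ofPath_mem_labelIdeal.mpr (hρ.ofPath_notMem hp)
  obtain ⟨ξ, hξ⟩ := Option.ne_none_iff_exists'.mp hnone
  exact h hξ ((label_eq_of_isMinimalRelation hρ hp hq).symm.trans hξ)

theorem homotopic_of_label_eq {x y : V} {p q : Quiver.Path x y} (h : ℓ.label p = ℓ.label q)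
    (hp : ℓ.label p ≠ none) : Homotopic (ℓ.labelIdeal k) (toWalk p) (toWalk q) := by
  rcases eq_or_ne p q with rfl | hpq
  · exact Homotopic.refl _
  · refine Homotopic.minimal _ (isMinimalRelation_single_sub_single hpq ?_ ?_ ?_) p q ?_ ?_
    · rwa [ofPath_mem_labelIdeal]
    · rwa [ofPath_mem_labelIdeal, ← h]
    · exact PathAlgebra.subset_spanIdeal (ofPath_sub_ofPath_mem_relations h)
    · simp [hpq]
    · simp [hpq.symm]

theorem isAdmissible_labelIdeal
    (hnone : ∀ {x y : V} {p : Quiver.Path x y}, ℓ.label p = none → 2 ≤ p.length)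
    (heq : ∀ {x y : V} {p q : Quiver.Path x y}, ℓ.label p = ℓ.label q →
      p = q ∨ 2 ≤ p.length ∧ 2 ≤ q.length)
    {m : ℕ} (hm : ∀ {x y : V} (p : Quiver.Path x y), p.length ≤ m) :
    IsAdmissible k (ℓ.labelIdeal k) where
  isTwoSided := inferInstance
  exists_pow_le := by
    refine ⟨m + 2, Nat.le_add_left 2 m, ?_⟩
    rw [PathAlgebra.arrowIdeal_pow]
    refine PathAlgebra.spanIdeal_le ?_
    rintro _ ⟨x, y, p, hp, rfl⟩
    have := hm p
    omega
  le_sq := by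
    rw [PathAlgebra.arrowIdeal_pow]
    refine PathAlgebra.spanIdeal_le ?_
    rintro _ (⟨x, y, p, hp, rfl⟩ | ⟨x, y, p, q, hpq, rfl⟩)
    · exact PathAlgebra.ofPath_mem_longPathIdeal (hnone hp)
    · rcases heq hpq with rfl | ⟨hp, hq⟩
      · exact (sub_self (ofPath p : PathAlgebra k V)) ▸ Ideal.zero_mem _
      · exact Ideal.sub_mem _ (PathAlgebra.ofPath_mem_longPathIdeal hp)
          (PathAlgebra.ofPath_mem_longPathIdeal hq)

end PathLabelling

/-! ### Transvections -/

/-- A substitution scheme on the arrows: `shift α = some β` means that a multiple of the parallel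
arrow `β` is to be added to `α`. The arrows that are added are not themselves modified. -/
structure ArrowShift (V : Type*) [Quiver V] where
  shift {x y : V} : (x ⟶ y) → Option (x ⟶ y)
  shift_eq_none {x y : V} {α β : x ⟶ y} : shift α = some β → shift β = none

namespace ArrowShift

open PathAlgebra

variable {V : Type*} [Quiver V] [Fintype V] (σ : ArrowShift V) {k : Type*} [Field k] (c : k)

/-- The endomorphism of the path algebra that replaces each arrow `α` with `shift α = some β` by
`α + c • β`. -/
def transvection : PathAlgebra k V →ₐ[k] PathAlgebra k V :=
  substHom
    (fun α => ofPath α.toPath + (σ.shift α).elim 0 fun β => c • ofPath β.toPath)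
    completeOrthogonalIdempotents_ofPath_nil

theorem transvection_nil (x : V) :
    σ.transvection c (ofPath (.nil : Quiver.Path x x)) = ofPath (.nil : Quiver.Path x x) :=
  substHom_nil ..

theorem transvection_arrow {x y : V} (α : x ⟶ y) :
    σ.transvection c (ofPath α.toPath) =
      ofPath α.toPath + (σ.shift α).elim 0 fun β => c • ofPath β.toPath := by
  have h (β : x ⟶ y) :
      (ofPath (.nil : Quiver.Path x x) * (ofPath β.toPath * ofPath (.nil : Quiver.Path y y)) :
        PathAlgebra k V) = ofPath β.toPath := by
    rw [ofPath_mul_ofPath_comp, ofPath_mul_ofPath_comp, Quiver.Path.comp_nil,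
      Quiver.Path.nil_comp]
  refine (substHom_arrow ..).trans ?_
  cases σ.shift α <;>
    simp only [Option.elim, add_mul, mul_add, smul_mul_assoc, mul_smul_comm, h, add_zero]

theorem transvection_comp_transvection_neg :
    (σ.transvection c).comp (σ.transvection (-c)) = AlgHom.id k (PathAlgebra k V) := by
  refine algHom_ext (fun x => ?_) fun x y α => ?_
  · rw [AlgHom.comp_apply, transvection_nil, transvection_nil, AlgHom.id_apply]
  · rw [AlgHom.comp_apply, transvection_arrow, map_add, transvection_arrow, AlgHom.id_apply]
    cases h : σ.shift α with
    | none => simp only [Option.elim, map_zero, add_zero]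
    | some β =>
      simp only [Option.elim, neg_smul, map_neg, map_smul, transvection_arrow, σ.shift_eq_none h,
        add_zero, add_neg_cancel_right]

theorem transvection_transvection_neg (f : PathAlgebra k V) :
    σ.transvection c (σ.transvection (-c) f) = f :=
  DFunLike.congr_fun (σ.transvection_comp_transvection_neg c) f

theorem transvection_ofPath_mem_longPathIdeal {x y : V} (p : Quiver.Path x y) :
    σ.transvection c (ofPath p) ∈ longPathIdeal k V p.length := by
  induction p with
  | nil =>
    rw [transvection_nil]
    exact ofPath_mem_longPathIdeal le_rfl
  | @cons y z p α ih =>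
    have hα (β : y ⟶ z) : ofPath β.toPath ∈ longPathIdeal k V 1 :=
      ofPath_mem_longPathIdeal (p := β.toPath) le_rfl
    rw [ofPath_cons, map_mul, transvection_arrow]
    refine longPathIdeal_mul_le _ 1 (Ideal.mul_mem_mul ih (Ideal.add_mem _ (hα α) ?_))
    cases σ.shift α with
    | none => exact Ideal.zero_mem _
    | some β => exact Submodule.smul_of_tower_mem _ c (hα β)

theorem transvection_mem_longPathIdeal {n : ℕ} {f : PathAlgebra k V}
    (hf : f ∈ longPathIdeal k V n) : σ.transvection c f ∈ longPathIdeal k V n := by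
  suffices h : longPathIdeal k V n ≤ (longPathIdeal k V n).comap (σ.transvection c) from h hf
  refine spanIdeal_le ?_
  rintro _ ⟨x, y, p, hp, rfl⟩
  have h := σ.transvection_ofPath_mem_longPathIdeal c p
  rw [← arrowIdeal_pow] at h
  change _ ∈ longPathIdeal k V n
  rw [← arrowIdeal_pow]
  exact Ideal.pow_le_pow_right hp h

end ArrowShift

theorem PathLabelling.transvection_mem_labelIdeal_iff {V X : Type*} [Quiver V] [Fintype V]
    {ℓ ℓ' : PathLabelling V X} {k : Type*} [Field k] (hℓ : IsAdmissible k (ℓ.labelIdeal k))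
    (hℓ' : IsAdmissible k (ℓ'.labelIdeal k)) {σ : ArrowShift V} {c : k}
    (h : ∀ {x y : V} (p : Quiver.Path x y), 2 ≤ p.length →
      ℓ.labelMap k (σ.transvection c (PathAlgebra.ofPath p)) =
        ℓ'.labelMap k (PathAlgebra.ofPath p))
    {f : PathAlgebra k V} : σ.transvection c f ∈ ℓ.labelIdeal k ↔ f ∈ ℓ'.labelIdeal k := by
  have hlong : ∀ g ∈ PathAlgebra.longPathIdeal k V 2,
      ℓ.labelMap k (σ.transvection c g) = ℓ'.labelMap k g := by
    refine LinearMap.eqOn_span (f := ℓ.labelMap k ∘ₗ (σ.transvection c).toLinearMap) ?_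
    rintro _ ⟨x, y, p, hp, rfl⟩
    exact h p hp
  rw [mem_labelIdeal, mem_labelIdeal]
  have hle {ℓ : PathLabelling V X} (hℓ : IsAdmissible k (ℓ.labelIdeal k)) :
      ℓ.labelIdeal k ≤ PathAlgebra.longPathIdeal k V 2 :=
    hℓ.le_sq.trans_eq (PathAlgebra.arrowIdeal_pow 2)
  constructor <;> intro hf
  · have hmem := σ.transvection_mem_longPathIdeal (-c) (hle hℓ (mem_labelIdeal.mpr hf))
    have hinv : σ.transvection (-c) (σ.transvection c f) = f := by
      simpa only [neg_neg] using σ.transvection_transvection_neg (-c) f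
    rw [← hlong f (hinv ▸ hmem), hf]
  · rw [hlong f (hle hℓ' (mem_labelIdeal.mpr hf)), hf]

section Presentation

variable {k : Type*} [Field k] {Q : FinConnQuiver} {I I' : Ideal (PathAlgebra k Q.Vert)}

theorem isPresentation_quotient [I.IsTwoSided] (hI : IsAdmissible k I) :
    IsPresentation k Q I (PathAlgebra k Q.Vert ⧸ I) :=
  ⟨hI, Ideal.Quotient.mkₐ k I, Ideal.Quotient.mkₐ_surjective k I, Ideal.Quotient.mkₐ_ker k I⟩

theorem IsPresentation.comp {A : Type*} [Ring A] [Algebra k A] (h : IsPresentation k Q I A)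
    (hI' : IsAdmissible k I') {φ : PathAlgebra k Q.Vert →ₐ[k] PathAlgebra k Q.Vert}
    (hφ : Function.Surjective φ) (hmem : ∀ f, φ f ∈ I ↔ f ∈ I') : IsPresentation k Q I' A := by
  obtain ⟨-, ν, hν, rfl⟩ := h
  exact ⟨hI', ν.comp φ, hν.comp hφ, Ideal.ext hmem⟩

end Presentation

namespace PathLabelling

/-! ### Labellings of the paths of maximal length -/

section MaximalLength

variable {V C : Type*} [Quiver V] {n : ℕ}
  (hn : ∀ {x y : V} (p : Quiver.Path x y), p.length ≤ n)
  {lab : ∀ {x y : V}, Quiver.Path x y → Option C} {x y : V} {p q : Quiver.Path x y}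

/-- The labels of `ofMaximalLength`. -/
def maximalLabel (n : ℕ) (lab : ∀ {x y : V}, Quiver.Path x y → Option C) {x y : V}
    (p : Quiver.Path x y) : Option (TotalPath V ⊕ C) :=
  if p.length < n then some (.inl ⟨x, y, p⟩) else (lab p).map .inr

theorem maximalLabel_of_lt (h : p.length < n) : maximalLabel n lab p = some (.inl ⟨x, y, p⟩) :=
  if_pos h

theorem maximalLabel_of_le (h : n ≤ p.length) : maximalLabel n lab p = (lab p).map .inr :=
  if_neg h.not_gt

theorem le_length_of_maximalLabel_eq_none (h : maximalLabel n lab p = none) : n ≤ p.length := by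
  by_contra! hp
  exact Option.some_ne_none _ ((maximalLabel_of_lt hp).symm.trans h)

theorem eq_or_le_length_of_maximalLabel_eq (h : maximalLabel n lab p = maximalLabel n lab q) :
    p = q ∨ n ≤ p.length ∧ n ≤ q.length := by
  rcases lt_or_ge p.length n with hp | hp <;> rcases lt_or_ge q.length n with hq | hq
  · rw [maximalLabel_of_lt hp, maximalLabel_of_lt hq] at h
    cases h
    exact .inl rfl
  · rw [maximalLabel_of_lt hp, maximalLabel_of_le hq] at h
    simp [eq_comm] at h
  · rw [maximalLabel_of_le hp, maximalLabel_of_lt hq] at h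
    simp at h
  · exact .inr ⟨hp, hq⟩

include hn in
theorem rel_comp_comp_of_le_length (rel : ∀ {x y : V}, Quiver.Path x y → Quiver.Path x y → Prop)
    {z t : V} (r : Quiver.Path z x) (s : Quiver.Path y t) (hp : n ≤ p.length) (hpq : rel p q) :
    rel ((r.comp p).comp s) ((r.comp q).comp s) := by
  have h := hn ((r.comp p).comp s)
  rw [Quiver.Path.length_comp, Quiver.Path.length_comp] at h
  obtain rfl := Quiver.Path.eq_of_length_zero r (by omega)
  obtain rfl := Quiver.Path.eq_of_length_zero s (by omega)
  obtain rfl := Quiver.Path.eq_nil_of_length_zero r (by omega)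
  obtain rfl := Quiver.Path.eq_nil_of_length_zero s (by omega)
  simpa only [Quiver.Path.nil_comp, Quiver.Path.comp_nil] using hpq

/-- A labelling for which only the paths of maximal length `n` take part in relations: these have
the labels prescribed by `lab`, the other ones are their own labels. -/
def ofMaximalLength (lab : ∀ {x y : V}, Quiver.Path x y → Option C) :
    PathLabelling V (TotalPath V ⊕ C) where
  label := maximalLabel n lab
  label_comp_eq_none r p s h := rel_comp_comp_of_le_length hn
    (fun p _ => maximalLabel n lab p = none) r s (le_length_of_maximalLabel_eq_none h) (q := p) h
  label_comp_congr r p q s h := by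
    rcases eq_or_le_length_of_maximalLabel_eq h with rfl | ⟨hp, -⟩
    · rfl
    · exact rel_comp_comp_of_le_length hn
        (fun p q => maximalLabel n lab p = maximalLabel n lab q) r s hp h

theorem ofMaximalLength_label_of_le (h : n ≤ p.length) :
    (ofMaximalLength hn lab).label p = (lab p).map .inr :=
  maximalLabel_of_le h

variable [Fintype V] {k : Type*} [Field k]

theorem isAdmissible_ofMaximalLength (h : 2 ≤ n) :
    IsAdmissible k ((ofMaximalLength hn lab).labelIdeal k) :=
  isAdmissible_labelIdeal (fun hp => h.trans (le_length_of_maximalLabel_eq_none hp))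
    (fun hpq => (eq_or_le_length_of_maximalLabel_eq hpq).imp_right
      fun hlen => ⟨h.trans hlen.1, h.trans hlen.2⟩) hn

theorem respectsRelations_ofMaximalLength {G : Type*} [Group G]
    {val : ∀ {x y : V}, (x ⟶ y) → G}
    (h : ∀ {x y : V} {p q : Quiver.Path x y} {c : C}, lab p = some c → lab q = some c →
      walkWeight val (toWalk p) = walkWeight val (toWalk q)) :
    RespectsRelations ((ofMaximalLength hn lab).labelIdeal k) val := by
  refine respectsRelations fun {x y p q ξ} hp hq => ?_
  rcases eq_or_le_length_of_maximalLabel_eq (hp.trans hq.symm) with rfl | ⟨hlp, hlq⟩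
  · rfl
  · obtain ⟨c, hc, rfl⟩ := Option.map_eq_some_iff.mp ((maximalLabel_of_le hlp).symm.trans hp)
    obtain ⟨c', hc', hcc'⟩ := Option.map_eq_some_iff.mp ((maximalLabel_of_le hlq).symm.trans hq)
    exact h hc (Sum.inr_injective hcc' ▸ hc')

end MaximalLength

end PathLabelling

/-! ### Star quivers -/

/-- The vertices of the star quiver with rays indexed by `J`: the ray `j` consists of the arrows
`A j` from `center` to `mid j` followed by the arrows `P j` from `mid j` to `fin j`. -/
inductive StarQuiver {J : Type} (A P : J → Type) : Type
  | center : StarQuiver A P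
  | mid (j : J) : StarQuiver A P
  | fin (j : J) : StarQuiver A P

namespace StarQuiver

variable {J : Type} {A P : J → Type}

/-- The arrows of the star quiver. -/
inductive Hom (A P : J → Type) : StarQuiver A P → StarQuiver A P → Type
  | fst {j : J} (a : A j) : Hom A P center (mid j)
  | snd {j : J} (p : P j) : Hom A P (mid j) (fin j)

instance : Quiver (StarQuiver A P) := ⟨Hom A P⟩

/-- The arrow `a` of the first layer. -/
def fst {j : J} (a : A j) : (center : StarQuiver A P) ⟶ mid j := Hom.fst a

/-- The arrow `p` of the second layer. -/
def snd {j : J} (p : P j) : (mid j : StarQuiver A P) ⟶ fin j := Hom.snd p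

/-- The path of length two consisting of the arrows `a` and `p`. -/
def two {j : J} (a : A j) (p : P j) : Quiver.Path (center : StarQuiver A P) (fin j) :=
  (fst a).toPath.comp (snd p).toPath

theorem path_cases {motive : ∀ {x y : StarQuiver A P}, Quiver.Path x y → Prop}
    (nil : ∀ x : StarQuiver A P, motive (Quiver.Path.nil : Quiver.Path x x))
    (fst : ∀ {j : J} (a : A j), motive (fst a).toPath)
    (snd : ∀ {j : J} (p : P j), motive (snd p).toPath)
    (two : ∀ {j : J} (a : A j) (p : P j), motive (two a p)) :
    ∀ {x y : StarQuiver A P} (p : Quiver.Path x y), motive p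
  | _, _, .nil => nil _
  | _, _, .cons .nil (Hom.fst a) => fst a
  | _, _, .cons .nil (Hom.snd p) => snd p
  | _, _, .cons (.cons .nil (Hom.fst a)) (Hom.snd p) => two a p

theorem length_le_two {x y : StarQuiver A P} (p : Quiver.Path x y) : p.length ≤ 2 :=
  path_cases (motive := fun p => p.length ≤ 2) (fun _ => Nat.zero_le _) (fun _ => by simp)
    (fun _ => by simp) (fun _ _ => le_rfl) p

theorem isAcyclic : IsAcyclic (StarQuiver A P) := by
  intro x p
  refine Quiver.Path.eq_nil_of_length_zero p ?_
  exact path_cases (motive := fun {x y} p => x = y → p.length = 0) (fun _ _ => rfl)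
    (fun _ => nofun) (fun _ => nofun) (fun _ _ => nofun) p rfl

section FinConnQuiver

instance [Finite J] : Finite (StarQuiver A P) :=
  Finite.of_surjective
    (fun x : Option (J ⊕ J) => match x with
      | none => center
      | some (Sum.inl j) => mid j
      | some (Sum.inr j) => fin j)
    (by
      rintro (_ | j | j)
      exacts [⟨none, rfl⟩, ⟨some (.inl j), rfl⟩, ⟨some (.inr j), rfl⟩])

instance [Finite J] : Fintype (StarQuiver A P) := Fintype.ofFinite _

instance [Finite J] [∀ j, Finite (A j)] [∀ j, Finite (P j)] (x y : StarQuiver A P) :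
    Finite (x ⟶ y) :=
  Finite.of_injective
    (fun α : Hom A P x y => match α with
      | Hom.fst a => (Sum.inl ⟨_, a⟩ : (Σ j, A j) ⊕ Σ j, P j)
      | Hom.snd p => Sum.inr ⟨_, p⟩)
    (by
      intro (α : Hom A P x y) (β : Hom A P x y) h
      cases α <;> cases β <;> simp_all)

variable (a₀ : ∀ j, A j) (p₀ : ∀ j, P j)

/-- The walk from the center to a vertex along the base arrows `a₀ j` and `p₀ j`. -/
def baseWalk : ∀ x : StarQuiver A P,
    Walk (Quiver.Symmetrify.of.obj (center : StarQuiver A P)) (Quiver.Symmetrify.of.obj x)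
  | center => .nil
  | mid j => arrowWalk (fst (a₀ j))
  | fin j => (arrowWalk (fst (a₀ j))).comp (arrowWalk (snd (p₀ j)))

/-- The star quiver as a finite connected quiver. -/
abbrev toFinConnQuiver [Finite J] [∀ j, Finite (A j)] [∀ j, Finite (P j)] : FinConnQuiver where
  Vert := StarQuiver A P
  nonempty := ⟨center⟩
  connected x y := ⟨(baseWalk a₀ p₀ x).reverse.comp (baseWalk a₀ p₀ y)⟩

end FinConnQuiver

end StarQuiver

section RayWeight

variable {A P C : Type}

/-- Weights in a group `K` of the two layers of arrows `A` and `P` of a ray of a star quiver: the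
base arrows have trivial weight, and paths with the same label have the same weight. -/
structure IsRayWeight (lab : A → P → Option C) (a₀ : A) (p₀ : P) {K : Type*} [Group K] (f : A → K)
    (g : P → K) : Prop where
  base_fst : f a₀ = 1
  base_snd : g p₀ = 1
  compatible {a a' : A} {p p' : P} {c : C} :
    lab a p = some c → lab a' p' = some c → f a * g p = f a' * g p'

theorem IsRayWeight.map {lab : A → P → Option C} {a₀ : A} {p₀ : P} {K L : Type*} [Group K]
    [Group L] {f : A → K} {g : P → K} (h : IsRayWeight lab a₀ p₀ f g) (φ : K →* L) :
    IsRayWeight lab a₀ p₀ (fun a => φ (f a)) fun p => φ (g p) where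
  base_fst := by rw [h.base_fst, map_one]
  base_snd := by rw [h.base_snd, map_one]
  compatible hc hc' := by rw [← map_mul, ← map_mul, h.compatible hc hc']

/-- `f` and `g` are the universal weights of a ray, with values in the group generated by the arrows
subject to the relations of `IsRayWeight`. -/
structure IsUniversalRayWeight (lab : A → P → Option C) (a₀ : A) (p₀ : P) {G : Type*} [Group G]
    (f : A → G) (g : P → G) : Prop extends IsRayWeight lab a₀ p₀ f g where
  exists_hom {K : Type} [Group K] {f' : A → K} {g' : P → K} : IsRayWeight lab a₀ p₀ f' g' →
    ∃ ψ : G →* K, (∀ a, ψ (f a) = f' a) ∧ ∀ p, ψ (g p) = g' p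
  closure_eq_top : Subgroup.closure (Set.range f ∪ Set.range g) = ⊤

end RayWeight

namespace StarQuiver

variable {J : Type} {A P C : J → Type} {lab : ∀ j, A j → P j → Option (C j)}

/-- The labels of the paths of length two, prescribed on each ray. -/
def pathLabel (lab : ∀ j, A j → P j → Option (C j)) :
    ∀ {x y : StarQuiver A P}, Quiver.Path x y → Option (Σ j, C j)
  | _, _, .cons (.cons .nil (Hom.fst a)) (Hom.snd p) => (lab _ a p).map (Sigma.mk _)
  | _, _, _ => none

/-- The labelling of a star quiver with prescribed labels of the paths of length two of each ray. -/
def labelling (lab : ∀ j, A j → P j → Option (C j)) :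
    PathLabelling (StarQuiver A P) (TotalPath (StarQuiver A P) ⊕ Σ j, C j) :=
  .ofMaximalLength length_le_two (pathLabel lab)

theorem labelling_label_two {j : J} (a : A j) (p : P j) :
    (labelling lab).label (two a p) = (lab j a p).map fun c => .inr ⟨j, c⟩ :=
  (PathLabelling.ofMaximalLength_label_of_le length_le_two le_rfl).trans (Option.map_map ..)

section Weight

variable {K : Type*} [Group K]

/-- The weights of the arrows of a star quiver, given on the two layers of each ray. -/
def arrowWeight (f : ∀ j, A j → K) (g : ∀ j, P j → K) : ∀ {x y : StarQuiver A P}, (x ⟶ y) → K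
  | _, _, Hom.fst a => f _ a
  | _, _, Hom.snd p => g _ p

variable {f : ∀ j, A j → K} {g : ∀ j, P j → K}

theorem walkWeight_two {j : J} (a : A j) (p : P j) :
    walkWeight (arrowWeight f g) (toWalk (two a p)) = f j a * g j p :=
  congrArg (· * g j p) (one_mul (f j a))

theorem exists_of_pathLabel_eq_some {j : J} {c : C j} {x y : StarQuiver A P}
    {q : Quiver.Path x y} : pathLabel lab q = some ⟨j, c⟩ → ∃ a p, lab j a p = some c ∧
      walkWeight (arrowWeight f g) (toWalk q) = f j a * g j p := by
  refine path_cases (motive := fun q => pathLabel lab q = some ⟨j, c⟩ → ∃ a p,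
    lab j a p = some c ∧ walkWeight (arrowWeight f g) (toWalk q) = f j a * g j p)
    (fun _ => nofun) (fun _ => nofun) (fun _ => nofun) (fun a p h => ?_) q
  obtain ⟨c', hc', h'⟩ := Option.map_eq_some_iff.mp h
  cases h'
  exact ⟨a, p, hc', walkWeight_two a p⟩

variable {a₀ : ∀ j, A j} {p₀ : ∀ j, P j}

theorem walkWeight_baseWalk (h : ∀ j, IsRayWeight (lab j) (a₀ j) (p₀ j) (f j) (g j))
    (x : StarQuiver A P) : walkWeight (arrowWeight f g) (baseWalk a₀ p₀ x) = 1 := by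
  have hfst (j : J) : walkWeight (arrowWeight f g) (arrowWalk (fst (P := P) (a₀ j))) = 1 :=
    (walkWeight_arrowWalk ..).trans (h j).base_fst
  have hsnd (j : J) : walkWeight (arrowWeight f g) (arrowWalk (snd (A := A) (p₀ j))) = 1 :=
    (walkWeight_arrowWalk ..).trans (h j).base_snd
  cases x with
  | center => rfl
  | mid j => exact hfst j
  | fin j => exact (walkWeight_comp ..).trans (by rw [hfst, hsnd, mul_one])

end Weight

section TreeWalk

variable (a₀ : ∀ j, A j) (p₀ : ∀ j, P j)

/-- The walk through the center along base arrows from `v₀` to a vertex. -/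
def treeWalk (v₀ : StarQuiver A P) (x : Quiver.Symmetrify (StarQuiver A P)) :
    Walk (Quiver.Symmetrify.of.obj v₀) x :=
  (baseWalk a₀ p₀ v₀).reverse.comp (baseWalk a₀ p₀ x)

theorem treeWalk_mid (v₀ : StarQuiver A P) (j : J) :
    (treeWalk a₀ p₀ v₀ center).comp (arrowWalk (fst (a₀ j))) = treeWalk a₀ p₀ v₀ (mid j) :=
  rfl

theorem treeWalk_fin (v₀ : StarQuiver A P) (j : J) :
    (treeWalk a₀ p₀ v₀ (mid j)).comp (arrowWalk (snd (p₀ j))) = treeWalk a₀ p₀ v₀ (fin j) :=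
  Quiver.Path.comp_assoc ..

end TreeWalk

section FundamentalGroup

variable [Finite J] {k : Type*} [Field k] {a₀ : ∀ j, A j} {p₀ : ∀ j, P j} (v₀ : StarQuiver A P)

theorem isAdmissible_labelIdeal : IsAdmissible k ((labelling lab).labelIdeal k) :=
  PathLabelling.isAdmissible_ofMaximalLength length_le_two le_rfl

theorem respectsRelations {K : Type*} [Group K] {f : ∀ j, A j → K} {g : ∀ j, P j → K}
    (h : ∀ j, IsRayWeight (lab j) (a₀ j) (p₀ j) (f j) (g j)) :
    RespectsRelations ((labelling lab).labelIdeal k) (arrowWeight f g) := by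
  refine PathLabelling.respectsRelations_ofMaximalLength length_le_two fun {_ _ p q c} hp hq => ?_
  obtain ⟨a, b, hab, hwp⟩ := exists_of_pathLabel_eq_some (f := f) (g := g) hp
  obtain ⟨a', b', hab', hwq⟩ := exists_of_pathLabel_eq_some (f := f) (g := g) hq
  rw [hwp, hwq, (h c.1).compatible hab hab']

variable (lab k a₀ p₀) in
/-- The class of an arrow of a star quiver, closed up along the base arrows. -/
abbrev arrowClass {x y : StarQuiver A P} (α : x ⟶ y) :
    FundamentalGroup ((labelling lab).labelIdeal k) v₀ :=
  loopClass _ (treeWalk a₀ p₀ v₀) (arrowWalk α)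

theorem isRayWeight_arrowClass (j : J) :
    IsRayWeight (lab j) (a₀ j) (p₀ j) (fun a => arrowClass lab k a₀ p₀ v₀ (fst a))
      fun p => arrowClass lab k a₀ p₀ v₀ (snd p) where
  base_fst := loopClass_eq_one (treeWalk_mid a₀ p₀ v₀ j)
  base_snd := loopClass_eq_one (treeWalk_fin a₀ p₀ v₀ j)
  compatible {a a' p p' c} hc hc' := by
    have htwo (a : A j) (p : P j) : arrowClass lab k a₀ p₀ v₀ (fst a) *
        arrowClass lab k a₀ p₀ v₀ (snd p) = loopClass _ (treeWalk a₀ p₀ v₀) (toWalk (two a p)) :=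
      (loopClass_comp ..).symm
    have hlab : (labelling lab).label (two a p) = some (.inr ⟨j, c⟩) := by
      rw [labelling_label_two, hc, Option.map_some]
    have hlab' : (labelling lab).label (two a' p') = some (.inr ⟨j, c⟩) := by
      rw [labelling_label_two, hc', Option.map_some]
    rw [htwo, htwo]
    exact loopClass_congr (PathLabelling.homotopic_of_label_eq (hlab.trans hlab'.symm)
      (hlab ▸ Option.some_ne_none _))

theorem homotopic_treeWalk (I : Ideal (PathAlgebra k (StarQuiver A P))) :
    Homotopic I (treeWalk a₀ p₀ v₀ (Quiver.Symmetrify.of.obj v₀)) Quiver.Path.nil :=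
  Homotopic.reverse_comp I _

theorem nonempty_fundamentalGroup_mulEquiv_coprodI {G : J → Type} [∀ j, Group (G j)]
    {f : ∀ j, A j → G j} {g : ∀ j, P j → G j}
    (h : ∀ j, IsUniversalRayWeight (lab j) (a₀ j) (p₀ j) (f j) (g j)) :
    Nonempty (FundamentalGroup ((labelling lab).labelIdeal k) v₀ ≃* Monoid.CoprodI G) := by
  have hweight (j : J) : IsRayWeight (lab j) (a₀ j) (p₀ j)
      (fun a => (Monoid.CoprodI.of (f j a) : Monoid.CoprodI G)) fun p => .of (g j p) :=
    (h j).toIsRayWeight.map Monoid.CoprodI.of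
  choose ψ hψf hψg using fun j => (h j).exists_hom (isRayWeight_arrowClass (k := k) v₀ j)
  refine nonempty_fundamentalGroup_mulEquiv (homotopic_treeWalk (a₀ := a₀) (p₀ := p₀) v₀ _)
    (respectsRelations hweight) (fun x => ?_) (Monoid.CoprodI.lift ψ) ?_ fun θ hθ => ?_
  · refine (walkWeight_comp ..).trans ?_
    rw [walkWeight_reverse, walkWeight_baseWalk hweight, inv_one, one_mul]
    exact walkWeight_baseWalk hweight x
  · rintro _ _ (a | p)
    · exact (Monoid.CoprodI.lift_of ..).trans (hψf _ a)
    · exact (Monoid.CoprodI.lift_of ..).trans (hψg _ p)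
  · refine Monoid.CoprodI.ext_hom _ _ fun j =>
      MonoidHom.eq_of_eqOn_dense (h j).closure_eq_top ?_
    rintro _ (⟨a, rfl⟩ | ⟨p, rfl⟩)
    · exact hθ _ _ (fst a)
    · exact hθ _ _ (snd p)

theorem subsingleton_fundamentalGroup
    (h : ∀ (j : J) {K : Type} [Group K] {f : A j → K} {g : P j → K},
      IsRayWeight (lab j) (a₀ j) (p₀ j) f g → (∀ a, f a = 1) ∧ ∀ p, g p = 1) :
    Subsingleton (FundamentalGroup ((labelling lab).labelIdeal k) v₀) := by
  refine BoundQuiver.subsingleton_fundamentalGroup (homotopic_treeWalk (a₀ := a₀) (p₀ := p₀) v₀ _)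
    ?_
  rintro _ _ (a | p)
  · exact (h _ (isRayWeight_arrowClass v₀ _)).1 a
  · exact (h _ (isRayWeight_arrowClass v₀ _)).2 p

end FundamentalGroup

end StarQuiver

/-- The labels `lab'` of a ray describe the preimage of the relations given by `lab` under the
transvection that adds to each arrow `a` of the first layer the arrow `shift a`, if there is one:
a path `a p` with `shift a = some b` is sent to the sum of `a p` and `b p`, at most one of which
may have a label. -/
structure IsTwist {A P C : Type} (shift : A → Option A) (lab lab' : A → P → Option C) : Prop where
  shift_eq_none {a b : A} : shift a = some b → shift b = none
  label_of_eq_none {a : A} : shift a = none → ∀ p, lab' a p = lab a p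
  label_of_eq_some {a b : A} : shift a = some b → ∀ p,
    lab a p = none ∧ lab' a p = lab b p ∨ lab b p = none ∧ lab' a p = lab a p

namespace StarQuiver

open PathAlgebra

variable {J : Type} {A P C : J → Type} {shift : ∀ j, A j → Option (A j)}
  {lab lab' : ∀ j, A j → P j → Option (C j)}

/-- The modification of the arrows of the first layer of each ray of a star quiver. -/
def arrowShift (h : ∀ j, IsTwist (shift j) (lab j) (lab' j)) :
    ArrowShift (StarQuiver A P) where
  shift
    | Hom.fst a => (shift _ a).map Hom.fst
    | Hom.snd _ => none
  shift_eq_none {x y} α β hα := by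
    rcases α with a | p
    · obtain ⟨b, hb, rfl⟩ := Option.map_eq_some_iff.mp hα
      exact Option.map_eq_none_iff.mpr ((h _).shift_eq_none hb)
    · exact absurd hα.symm (Option.some_ne_none _)

variable {k : Type u} [Field k]

theorem labelMap_two {j : J} (a : A j) (p : P j) :
    (labelling lab).labelMap k (ofPath (two a p)) =
      (lab j a p).elim 0 fun c => Finsupp.single (center, fin j, .inr ⟨j, c⟩) 1 := by
  rw [PathLabelling.labelMap_ofPath, labelling_label_two]
  cases lab j a p <;> rfl

variable [Finite J]

theorem transvection_two (h : ∀ j, IsTwist (shift j) (lab j) (lab' j)) (c : k) {j : J} (a : A j)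
    (p : P j) :
    (arrowShift h).transvection c (ofPath (two a p)) =
      ofPath (two a p) + (shift j a).elim 0 fun b => c • ofPath (two b p) := by
  have hsnd : (arrowShift h).transvection c (ofPath (snd p).toPath) =
      (ofPath (snd p).toPath : PathAlgebra k (StarQuiver A P)) :=
    ((arrowShift h).transvection_arrow c (snd p)).trans (add_zero _)
  have hmul (b : A j) : ofPath (two b p) = (ofPath (fst b).toPath * ofPath (snd p).toPath :
      PathAlgebra k (StarQuiver A P)) := (ofPath_mul_ofPath_comp ..).symm
  have hfst : (arrowShift h).shift (fst (P := P) a) = (shift j a).map fst := rfl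
  rw [hmul, map_mul, hsnd, ArrowShift.transvection_arrow, hfst, add_mul]
  cases shift j a with
  | none => exact congrArg _ (zero_mul _)
  | some b => simp only [Option.map_some, Option.elim_some, smul_mul_assoc, hmul]

theorem labelMap_transvection_two (h : ∀ j, IsTwist (shift j) (lab j) (lab' j)) {j : J} (a : A j)
    (p : P j) :
    (labelling lab).labelMap k
        ((arrowShift h).transvection 1 (ofPath (two a p))) =
      (labelling lab').labelMap k (ofPath (two a p)) := by
  rw [transvection_two, map_add, labelMap_two]
  cases hs : shift j a with
  | none =>
    simp only [Option.elim_none, map_zero, add_zero, labelMap_two, (h j).label_of_eq_none hs]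
  | some b =>
    rcases (h j).label_of_eq_some hs p with ⟨hnone, hlab'⟩ | ⟨hnone, hlab'⟩ <;>
      simp only [Option.elim_some, one_smul, labelMap_two, hnone, hlab', Option.elim_none,
        zero_add, add_zero]

theorem transvection_mem_labelIdeal_iff (h : ∀ j, IsTwist (shift j) (lab j) (lab' j))
    {f : PathAlgebra k (StarQuiver A P)} :
    (arrowShift h).transvection 1 f ∈ (labelling lab).labelIdeal k ↔
      f ∈ (labelling lab').labelIdeal k := by
  refine PathLabelling.transvection_mem_labelIdeal_iff isAdmissible_labelIdeal
    isAdmissible_labelIdeal fun q => ?_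
  refine path_cases (motive := fun q => 2 ≤ q.length → (labelling lab).labelMap k
    ((arrowShift h).transvection 1 (ofPath q)) =
      (labelling lab').labelMap k (ofPath q))
    (fun _ => nofun) (fun _ h => ?_) (fun _ h => ?_) (fun a p _ => labelMap_transvection_two h a p)
    q <;> exact absurd h (by simp)

theorem isTwinPresentation [∀ j, Finite (A j)] [∀ j, Finite (P j)] {a₀ : ∀ j, A j}
    {p₀ : ∀ j, P j} {G : J → Type} [∀ j, Group (G j)] {f : ∀ j, A j → G j} {g : ∀ j, P j → G j}
    (h : ∀ j, IsTwist (shift j) (lab j) (lab' j))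
    (hlab : ∀ j, IsUniversalRayWeight (lab j) (a₀ j) (p₀ j) (f j) (g j))
    (hlab' : ∀ (j : J) {K : Type} [Group K] {f : A j → K} {g : P j → K},
      IsRayWeight (lab' j) (a₀ j) (p₀ j) f g → (∀ a, f a = 1) ∧ ∀ p, g p = 1) :
    IsTwinPresentation k (toFinConnQuiver a₀ p₀) ((labelling lab).labelIdeal k)
      ((labelling lab').labelIdeal k)
      (PathAlgebra k (StarQuiver A P) ⧸ (labelling lab).labelIdeal k) (Monoid.CoprodI G) := by
  have hpres : IsPresentation k (toFinConnQuiver a₀ p₀) ((labelling lab).labelIdeal k)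
      (PathAlgebra k (StarQuiver A P) ⧸ (labelling lab).labelIdeal k) :=
    isPresentation_quotient isAdmissible_labelIdeal
  have hsurj : Function.Surjective ((arrowShift h).transvection (1 : k)) :=
    fun f => ⟨_, (arrowShift h).transvection_transvection_neg 1 f⟩
  exact {
    triangular := ⟨_, _, isAcyclic, hpres⟩
    acyclic := isAcyclic
    presentation := hpres
    presentation' := hpres.comp isAdmissible_labelIdeal hsurj
      fun f => transvection_mem_labelIdeal_iff h
    fundamentalGroup := fun v₀ => nonempty_fundamentalGroup_mulEquiv_coprodI v₀ hlab
    fundamentalGroup' := fun v₀ => subsingleton_fundamentalGroup v₀ hlab' }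

end StarQuiver

/-! ### Coproducts of star quivers -/

namespace PathLabelling

variable {V W X Y : Type*} [Quiver V] [Quiver W] {ℓ : PathLabelling V X} {ℓ' : PathLabelling W Y}
  {k : Type*} [Field k]

theorem labelMap_map {F : V ⥤q W} {φ : X → Y}
    (h : ∀ {x y : V} (p : Quiver.Path x y), ℓ'.label (F.mapPath p) = (ℓ.label p).map φ)
    (f : PathAlgebra k V) :
    ℓ'.labelMap k (PathAlgebra.map k F f) =
      Finsupp.lmapDomain k k (Prod.map F.obj (Prod.map F.obj φ)) (ℓ.labelMap k f) := by
  suffices h' : ℓ'.labelMap k ∘ₗ PathAlgebra.map k F =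
      Finsupp.lmapDomain k k (Prod.map F.obj (Prod.map F.obj φ)) ∘ₗ ℓ.labelMap k from
    LinearMap.congr_fun h' f
  refine PathAlgebra.lhom_ext fun x y p => ?_
  rw [LinearMap.comp_apply, LinearMap.comp_apply, PathAlgebra.map_ofPath, labelMap_ofPath, h,
    labelMap_ofPath]
  cases ℓ.label p with
  | none => rw [Option.map_none, Option.elim_none, Option.elim_none, map_zero]
  | some ξ =>
    rw [Option.map_some, Option.elim_some, Option.elim_some, Finsupp.lmapDomain_apply,
      Finsupp.mapDomain_single, Prod.map_apply, Prod.map_apply]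

theorem map_mem_labelIdeal [Fintype V] [Fintype W] {F : V ⥤q W} {φ : X → Y}
    (h : ∀ {x y : V} (p : Quiver.Path x y), ℓ'.label (F.mapPath p) = (ℓ.label p).map φ)
    {f : PathAlgebra k V} (hf : f ∈ ℓ.labelIdeal k) :
    PathAlgebra.map k F f ∈ ℓ'.labelIdeal k := by
  rw [mem_labelIdeal] at hf ⊢
  rw [labelMap_map h, hf, map_zero]

end PathLabelling

namespace StarQuiver

variable {J : Type} {A P C : J → Type}

/-- The inclusion of a ray of a star quiver, which is itself regarded as a star quiver. -/
def rayMap (A P : J → Type) (j : J) :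
    StarQuiver (fun _ : Unit => A j) (fun _ : Unit => P j) ⥤q StarQuiver A P where
  obj
    | center => center
    | mid _ => mid j
    | fin _ => fin j
  map
    | Hom.fst a => fst a
    | Hom.snd p => snd p

theorem isWedge_rayMap (A P : Bool → Type) :
    IsWedge (rayMap A P false) (rayMap A P true) center center where
  injective_left := by rintro (_ | _ | _) (_ | _ | _) h <;> first | rfl | cases h
  injective_right := by rintro (_ | _ | _) (_ | _ | _) h <;> first | rfl | cases h
  obj_eq_iff := by
    rintro (_ | _ | _) (_ | _ | _)
    case center.center => exact iff_of_true rfl ⟨rfl, rfl⟩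
    all_goals exact ⟨nofun, nofun⟩
  obj_surjective := by
    rintro (_ | (_ | _) | (_ | _))
    exacts [.inl ⟨center, rfl⟩, .inl ⟨mid (), rfl⟩, .inr ⟨mid (), rfl⟩, .inl ⟨fin (), rfl⟩,
      .inr ⟨fin (), rfl⟩]
  arrow_bijective := by
    constructor
    · rintro (⟨_, _, (a | a)⟩ | ⟨_, _, (a | a)⟩) (⟨_, _, (b | b)⟩ | ⟨_, _, (b | b)⟩) h <;>
        cases h <;> rfl
    · rintro ⟨_, _, (@⟨_ | _, a⟩ | @⟨_ | _, p⟩)⟩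
      exacts [⟨.inl ⟨_, _, fst (j := ()) a⟩, rfl⟩, ⟨.inr ⟨_, _, fst (j := ()) a⟩, rfl⟩,
        ⟨.inl ⟨_, _, snd (j := ()) p⟩, rfl⟩, ⟨.inr ⟨_, _, snd (j := ()) p⟩, rfl⟩]

theorem exists_eq_fin_of_two_le_length {x y : StarQuiver A P} {q : Quiver.Path x y} :
    2 ≤ q.length → ∃ j, x = center ∧ y = fin j := by
  refine path_cases (motive := fun {x y} q => 2 ≤ q.length → ∃ j, x = center ∧ y = fin j)
    (fun _ h => ?_) (fun _ h => ?_) (fun _ h => ?_) (fun {j} _ _ _ => ⟨j, rfl, rfl⟩) q <;>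
    exact absurd h (by simp)

theorem exists_eq_two {j : J} (q : Quiver.Path (center : StarQuiver A P) (fin j)) :
    ∃ a p, q = two a p := by
  obtain _ | ⟨q, _ | p⟩ := q
  obtain _ | ⟨q, a | _⟩ := q
  obtain _ | ⟨q, e⟩ := q
  · exact ⟨a, p, rfl⟩
  · nomatch e

section LabelIdeal

variable (lab : ∀ j, A j → P j → Option (C j))

theorem label_mapPath_rayMap (j : J) {x y : StarQuiver (fun _ : Unit => A j) fun _ => P j}
    (q : Quiver.Path x y) :
    (labelling lab).label ((rayMap A P j).mapPath q) =
      ((labelling fun _ => lab j).label q).map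
        (Sum.map (fun t => ⟨_, _, (rayMap A P j).mapPath t.path⟩) fun c => ⟨j, c.2⟩) := by
  refine path_cases (motive := fun q => (labelling lab).label ((rayMap A P j).mapPath q) =
      ((labelling fun _ => lab j).label q).map
        (Sum.map (fun t => ⟨_, _, (rayMap A P j).mapPath t.path⟩) fun c => ⟨j, c.2⟩))
    (fun _ => rfl) (fun _ => rfl) (fun _ => rfl) (fun a p => ?_) q
  rw [labelling_label_two, Option.map_map]
  exact labelling_label_two a p

variable {k : Type*} [Field k]

theorem map_rayMap_two (j : J) (a : A j) (p : P j) :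
    PathAlgebra.map k (rayMap A P j)
        (PathAlgebra.ofPath (two (A := fun _ => A j) (P := fun _ => P j) (j := ()) a p)) =
      PathAlgebra.ofPath (two a p) :=
  PathAlgebra.map_ofPath ..

variable [Finite J]

theorem map_rayMap_mem_labelIdeal (j : J)
    {f : PathAlgebra k (StarQuiver (fun _ : Unit => A j) fun _ => P j)}
    (hf : f ∈ (labelling fun _ => lab j).labelIdeal k) :
    PathAlgebra.map k (rayMap A P j) f ∈ (labelling lab).labelIdeal k :=
  PathLabelling.map_mem_labelIdeal (label_mapPath_rayMap lab j) hf

theorem labelIdeal_le {I : Ideal (PathAlgebra k (StarQuiver A P))}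
    (h : ∀ (j : J), ∀ f ∈ (labelling fun _ : Unit => lab j).labelIdeal k,
      PathAlgebra.map k (rayMap A P j) f ∈ I) :
    (labelling lab).labelIdeal k ≤ I := by
  refine PathAlgebra.spanIdeal_le ?_
  rintro _ (⟨x, y, q, hq, rfl⟩ | ⟨x, y, q, q', hqq', rfl⟩)
  · obtain ⟨j, rfl, rfl⟩ := exists_eq_fin_of_two_le_length
      (PathLabelling.le_length_of_maximalLabel_eq_none hq)
    obtain ⟨a, p, rfl⟩ := exists_eq_two q
    rw [labelling_label_two, Option.map_eq_none_iff] at hq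
    have hmem := h j (PathAlgebra.ofPath (two (j := ()) a p))
      (PathLabelling.ofPath_mem_labelIdeal.mpr
        (by rw [labelling_label_two, hq, Option.map_none]))
    rwa [map_rayMap_two] at hmem
  · rcases PathLabelling.eq_or_le_length_of_maximalLabel_eq hqq' with rfl | ⟨hlen, -⟩
    · rw [sub_self]
      exact I.zero_mem
    obtain ⟨j, rfl, rfl⟩ := exists_eq_fin_of_two_le_length hlen
    obtain ⟨a, p, rfl⟩ := exists_eq_two q
    obtain ⟨a', p', rfl⟩ := exists_eq_two q'
    have hlab : lab j a p = lab j a' p' := by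
      rw [labelling_label_two, labelling_label_two] at hqq'
      exact Option.map_injective (Sum.inr_injective.comp sigma_mk_injective) hqq'
    have hmem := h j
      (PathAlgebra.ofPath (two (j := ()) a p) - PathAlgebra.ofPath (two (j := ()) a' p'))
      (PathAlgebra.subset_spanIdeal (PathLabelling.ofPath_sub_ofPath_mem_relations
        (by rw [labelling_label_two, labelling_label_two, hlab])))
    rwa [map_sub, map_rayMap_two, map_rayMap_two] at hmem

theorem labelIdeal_eq_coproductIdeal {A P C : Bool → Type}
    (lab : ∀ j, A j → P j → Option (C j)) :
    (labelling lab).labelIdeal k = coproductIdeal (rayMap A P false) (rayMap A P true)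
      ((labelling fun _ => lab false).labelIdeal k)
      ((labelling fun _ => lab true).labelIdeal k) := by
  apply le_antisymm
  · refine labelIdeal_le lab fun j f hf => subset_twoSidedSpan ?_
    cases j
    exacts [.inl ⟨f, hf, rfl⟩, .inr ⟨f, hf, rfl⟩]
  · refine twoSidedSpan_le ?_
    rintro _ (⟨f, hf, rfl⟩ | ⟨f, hf, rfl⟩)
    exacts [map_rayMap_mem_labelIdeal lab false hf, map_rayMap_mem_labelIdeal lab true hf]

end LabelIdeal

end StarQuiver

/-! ### The star quiver of a finite presentation -/

/-- The arrows of the first layer of the ray of a presentation with generators `α`: the base arrow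
`one`, one arrow for each generator, and the arrow `shift`, which is added to the arrows of the
generators in order to pass from the first to the second presentation of the algebra. -/
inductive GenArrow (α : Type) : Type
  | shift : GenArrow α
  | one : GenArrow α
  | gen (i : α) : GenArrow α

namespace GenArrow

instance {α : Type} [Finite α] : Finite (GenArrow α) :=
  Finite.of_surjective
    (fun x : Option (Option α) => match x with
      | none => shift
      | some none => one
      | some (some i) => gen i)
    (by
      rintro (_ | _ | i)
      exacts [⟨none, rfl⟩, ⟨some none, rfl⟩, ⟨some (some i), rfl⟩])

/-- The replacement of the arrows of the generators by `shift`. -/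
def twist {α : Type} : GenArrow α → Option (GenArrow α)
  | gen _ => some shift
  | _ => none

end GenArrow

section FinitePresentation

open GenArrow

variable {α : Type} [DecidableEq α] (R : Set (FreeGroup α))

/-- The suffixes of the reduced words of the relators. -/
def relatorSuffixes : Set (List (α × Bool)) :=
  {l | ∃ r ∈ R, l <:+ r.toWord}

theorem finite_relatorSuffixes {R : Set (FreeGroup α)} (hR : R.Finite) :
    (relatorSuffixes R).Finite := by
  refine (hR.biUnion fun r _ => List.finite_toSet r.toWord.tails).subset ?_
  rintro l ⟨r, hr, hl⟩
  exact Set.mem_biUnion hr ((List.mem_tails l r.toWord).mpr hl)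

/-- The element of a presented group given by a suffix of a relator. -/
def suffixElement (s : relatorSuffixes R) : PresentedGroup R :=
  PresentedGroup.mk R (FreeGroup.mk s)

/-- The labels of the paths of length two in the ray of a presentation. The arrows of the second
layer are the base arrow `none` and one arrow for each suffix of a relator; the labels of the paths
from the generators to the base arrow distinguish the first presentation (`τ = false`) of the
algebra from the second one (`τ = true`). -/
def presLabel (τ : Bool) : GenArrow α → Option (relatorSuffixes R) → Option (PresentedGroup R)
  | shift, none => some 1
  | one, none => some 1
  | gen _, none => if τ then some 1 else none
  | shift, some _ => none
  | one, some s => some (suffixElement R s)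
  | gen i, some s => some (PresentedGroup.of i * suffixElement R s)

theorem isTwist_presLabel : IsTwist twist (presLabel R false) (presLabel R true) where
  shift_eq_none {a b} h := by
    cases a <;> cases h
    rfl
  label_of_eq_none {a} h p := by rcases a with _ | _ | i <;> cases h <;> cases p <;> rfl
  label_of_eq_some {a b} h p := by
    rcases a with _ | _ | i <;> cases h
    cases p
    exacts [.inl ⟨rfl, rfl⟩, .inr ⟨rfl, rfl⟩]

/-- The weights of the arrows of the first layer in the presented group. -/
def genWeight : GenArrow α → PresentedGroup R
  | gen i => PresentedGroup.of i
  | _ => 1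

/-- The weights of the arrows of the second layer in the presented group. -/
def suffixWeight : Option (relatorSuffixes R) → PresentedGroup R
  | some s => suffixElement R s
  | none => 1

variable {R}

theorem genWeight_mul_suffixWeight {a : GenArrow α} {p : Option (relatorSuffixes R)}
    {c : PresentedGroup R} (h : presLabel R false a p = some c) :
    genWeight R a * suffixWeight R p = c := by
  rcases a with _ | _ | i <;> rcases p with _ | s <;> cases h
  exacts [one_mul _, one_mul _, one_mul _, rfl]

theorem isRayWeight_genWeight_suffixWeight :
    IsRayWeight (presLabel R false) one none (genWeight R) (suffixWeight R) where
  base_fst := rfl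
  base_snd := rfl
  compatible hc hc' :=
    (genWeight_mul_suffixWeight hc).trans (genWeight_mul_suffixWeight hc').symm

namespace IsRayWeight

variable {τ : Bool} {K : Type*} [Group K] {f : GenArrow α → K} {g : Option (relatorSuffixes R) → K}

theorem eq_one_of_presLabel_eq_one (h : IsRayWeight (presLabel R τ) one none f g) {a : GenArrow α}
    (ha : presLabel R τ a none = some 1) : f a = 1 := by
  simpa only [h.base_fst, h.base_snd, mul_one] using h.compatible ha (a' := one) (p' := none) rfl

theorem suffix_eq_one (h : IsRayWeight (presLabel R τ) one none f g) {s : relatorSuffixes R}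
    (hs : suffixElement R s = 1) : g (some s) = 1 := by
  simpa only [h.base_fst, h.base_snd, one_mul] using
    h.compatible (a := one) (p := some s) (congrArg some hs) (a' := one) (p' := none) rfl

theorem suffix_eq_gen_mul (h : IsRayWeight (presLabel R τ) one none f g) {i : α}
    {s s' : relatorSuffixes R} (hs : suffixElement R s = PresentedGroup.of i * suffixElement R s') :
    g (some s) = f (gen i) * g (some s') := by
  simpa only [h.base_fst, one_mul] using
    h.compatible (a := one) (p := some s) (congrArg some hs) (a' := gen i) (p' := some s') rfl

/-- Consecutive suffixes of a relator differ by a generator, so the weights of the second layer are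
determined by those of the generators; the relator itself then says that its value is trivial. -/
theorem suffix_eq_lift (h : IsRayWeight (presLabel R τ) one none f g) {l : List (α × Bool)}
    (hl : l ∈ relatorSuffixes R) :
    g (some ⟨l, hl⟩) = FreeGroup.lift (fun i => f (gen i)) (FreeGroup.mk l) := by
  induction l with
  | nil => exact h.suffix_eq_one (map_one (PresentedGroup.mk R))
  | cons x l ih =>
    have hl' : l ∈ relatorSuffixes R :=
      hl.imp fun r hr => ⟨hr.1, (List.suffix_cons x l).trans hr.2⟩
    obtain ⟨i, _ | _⟩ := x
    · have hmk : (FreeGroup.mk l : FreeGroup α) =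
          FreeGroup.of i * FreeGroup.mk ((i, false) :: l) :=
        (mul_inv_cancel_left (FreeGroup.of i) (FreeGroup.mk l)).symm
      have hstep := h.suffix_eq_gen_mul (i := i) (s := ⟨l, hl'⟩) (s' := ⟨_, hl⟩)
        ((congrArg (PresentedGroup.mk R) hmk).trans (map_mul ..))
      rw [ih, hmk, map_mul, FreeGroup.lift_apply_of] at hstep
      exact (mul_left_cancel hstep).symm
    · have hmk : (FreeGroup.mk ((i, true) :: l) : FreeGroup α) = FreeGroup.of i * FreeGroup.mk l :=
        rfl
      rw [h.suffix_eq_gen_mul (i := i) (s := ⟨_, hl⟩) (s' := ⟨l, hl'⟩)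
        ((congrArg (PresentedGroup.mk R) hmk).trans (map_mul ..)), ih, hmk, map_mul,
        FreeGroup.lift_apply_of]

theorem lift_eq_one (h : IsRayWeight (presLabel R τ) one none f g) {r : FreeGroup α} (hr : r ∈ R) :
    FreeGroup.lift (fun i => f (gen i)) r = 1 := by
  have hsuffix : r.toWord ∈ relatorSuffixes R := ⟨r, hr, List.suffix_rfl⟩
  have hone : suffixElement R ⟨r.toWord, hsuffix⟩ = 1 := by
    rw [suffixElement, FreeGroup.mk_toWord]
    exact PresentedGroup.one_of_mem hr
  rw [← FreeGroup.mk_toWord (x := r), ← h.suffix_eq_lift hsuffix, h.suffix_eq_one hone]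

end IsRayWeight

theorem closure_range_genWeight_union_range_suffixWeight :
    Subgroup.closure (Set.range (genWeight R) ∪ Set.range (suffixWeight R)) = ⊤ := by
  refine top_unique ((PresentedGroup.closure_range_of R).ge.trans (Subgroup.closure_mono ?_))
  rintro _ ⟨i, rfl⟩
  exact .inl ⟨gen i, rfl⟩

theorem isUniversalRayWeight_genWeight_suffixWeight :
    IsUniversalRayWeight (presLabel R false) one none (genWeight R) (suffixWeight R) where
  toIsRayWeight := isRayWeight_genWeight_suffixWeight
  closure_eq_top := closure_range_genWeight_union_range_suffixWeight
  exists_hom {K _ f g} h := by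
    refine ⟨PresentedGroup.toGroup fun r hr => h.lift_eq_one hr, ?_, ?_⟩
    · rintro (_ | _ | i)
      · exact (map_one _).trans (h.eq_one_of_presLabel_eq_one rfl).symm
      · exact (map_one _).trans h.base_fst.symm
      · exact PresentedGroup.toGroup.of _
    · rintro (_ | ⟨l, hl⟩)
      · exact (map_one _).trans h.base_snd.symm
      · exact (h.suffix_eq_lift hl).symm

theorem IsRayWeight.eq_one {K : Type*} [Group K] {f : GenArrow α → K}
    {g : Option (relatorSuffixes R) → K} (h : IsRayWeight (presLabel R true) one none f g) :
    (∀ a, f a = 1) ∧ ∀ p, g p = 1 := by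
  have hf (a : GenArrow α) : f a = 1 := by
    rcases a with _ | _ | i <;> exact h.eq_one_of_presLabel_eq_one rfl
  refine ⟨hf, ?_⟩
  rintro (_ | ⟨l, hl⟩)
  · exact h.base_snd
  · have hlift : FreeGroup.lift (fun i => f (gen i)) = (1 : FreeGroup α →* K) :=
      FreeGroup.ext_hom _ _ fun i => (FreeGroup.lift_apply_of ..).trans (hf _)
    rw [h.suffix_eq_lift hl, hlift, MonoidHom.one_apply]

theorem isTwinPresentation_presLabel (k : Type u) [Field k] {J : Type} [Finite J] {α : J → Type}
    [∀ j, DecidableEq (α j)] [∀ j, Finite (α j)] (R : ∀ j, Set (FreeGroup (α j)))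
    [∀ j, Finite (relatorSuffixes (R j))] :
    IsTwinPresentation k (StarQuiver.toFinConnQuiver (fun _ => one) fun _ => none)
      ((StarQuiver.labelling fun j => presLabel (R j) false).labelIdeal k)
      ((StarQuiver.labelling fun j => presLabel (R j) true).labelIdeal k)
      (PathAlgebra k
          (StarQuiver (fun j => GenArrow (α j)) fun j => Option (relatorSuffixes (R j))) ⧸
        (StarQuiver.labelling fun j => presLabel (R j) false).labelIdeal k)
      (Monoid.CoprodI fun j => PresentedGroup (R j)) :=
  StarQuiver.isTwinPresentation (fun j => isTwist_presLabel (R j))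
    (fun _ => isUniversalRayWeight_genWeight_suffixWeight) fun _ _ _ _ _ h => h.eq_one

end FinitePresentation

theorem IsTwinPresentation.congr {k : Type*} [Field k] {Q : FinConnQuiver}
    {J J' : Ideal (PathAlgebra k Q.Vert)} {A : Type*} [Ring A] [Algebra k A] {G G' : Type*}
    [Group G] [Group G'] (h : IsTwinPresentation k Q J J' A G) (e : G ≃* G') :
    IsTwinPresentation k Q J J' A G' :=
  { h with fundamentalGroup := fun v => (h.fundamentalGroup v).map fun f => f.trans e }

/-- The free product over a type with one element is its only factor. -/
def coprodIUnitMulEquiv (G : Type*) [Group G] : Monoid.CoprodI (fun _ : Unit => G) ≃* G :=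
  MonoidHom.toMulEquiv (Monoid.CoprodI.lift fun _ => MonoidHom.id G)
    (Monoid.CoprodI.of (M := fun _ : Unit => G) (i := ()))
    (Monoid.CoprodI.ext_hom _ _ fun _ => rfl) rfl

/-- The free product over `Bool` is the free product of two groups. -/
def coprodIBoolMulEquiv (G : Bool → Type*) [∀ j, Group (G j)] :
    Monoid.CoprodI G ≃* Monoid.Coprod (G false) (G true) :=
  MonoidHom.toMulEquiv
    (Monoid.CoprodI.lift fun
      | false => Monoid.Coprod.inl
      | true => Monoid.Coprod.inr)
    (Monoid.Coprod.lift Monoid.CoprodI.of Monoid.CoprodI.of)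
    (Monoid.CoprodI.ext_hom _ _ (by rintro (_ | _) <;> rfl))
    (Monoid.Coprod.hom_ext rfl rfl)

/-- `G₁`, `G₂` and `G` are the fundamental groups of bound quivers `(O, L)`, `(QH, I)` and `(QG, J)`
without oriented cycles, the last one being the coproduct of the others, such that each of the three
algebras has a second presentation by the same quiver with trivial fundamental group, and these
second presentations are compatible with the coproduct. -/
def HasTwinWedge (k : Type u) [Field k] (G₁ G₂ G : Type*) [Group G₁] [Group G₂] [Group G] : Prop :=
  ∃ (O QH QG : FinConnQuiver) (L L' : Ideal (PathAlgebra k O.Vert))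
    (I I' : Ideal (PathAlgebra k QH.Vert)) (J J' : Ideal (PathAlgebra k QG.Vert))
    (AO : Type u) (_ : Ring AO) (_ : Algebra k AO) (AH : Type u) (_ : Ring AH) (_ : Algebra k AH)
    (A : Type u) (_ : Ring A) (_ : Algebra k A)
    (ι₁ : O.Vert ⥤q QG.Vert) (ι₂ : QH.Vert ⥤q QG.Vert) (v₁ : O.Vert) (v₂ : QH.Vert),
    IsTwinPresentation k QG J J' A G ∧ IsTwinPresentation k O L L' AO G₁ ∧
      IsTwinPresentation k QH I I' AH G₂ ∧ IsWedge ι₁ ι₂ v₁ v₂ ∧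
      J = coproductIdeal ι₁ ι₂ L I ∧ J' = coproductIdeal ι₁ ι₂ L' I'

section HasTwinWedge

variable {k : Type u} [Field k]

theorem HasTwinWedge.congr {G₁ G₂ G G₁' G₂' G' : Type*} [Group G₁] [Group G₂] [Group G]
    [Group G₁'] [Group G₂'] [Group G'] (h : HasTwinWedge k G₁ G₂ G) (e₁ : G₁ ≃* G₁')
    (e₂ : G₂ ≃* G₂') (e : G ≃* G') : HasTwinWedge k G₁' G₂' G' := by
  obtain ⟨O, QH, QG, L, L', I, I', J, J', AO, _, _, AH, _, _, A, _, _, ι₁, ι₂, v₁, v₂, hG, hO, hH,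
    h⟩ := h
  exact ⟨O, QH, QG, L, L', I, I', J, J', AO, _, _, AH, _, _, A, _, _, ι₁, ι₂, v₁, v₂, hG.congr e,
    hO.congr e₁, hH.congr e₂, h⟩

theorem hasTwinWedge_presentedGroup {α : Bool → Type} [∀ j, Finite (α j)]
    (R : ∀ j, Set (FreeGroup (α j))) (hR : ∀ j, (R j).Finite) :
    HasTwinWedge k (PresentedGroup (R false)) (PresentedGroup (R true))
      (Monoid.Coprod (PresentedGroup (R false)) (PresentedGroup (R true))) := by
  classical
  have (j : Bool) : Finite (relatorSuffixes (R j)) := (finite_relatorSuffixes (hR j)).to_subtype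
  have hray (j : Bool) :=
    (isTwinPresentation_presLabel k fun _ : Unit => R j).congr (coprodIUnitMulEquiv _)
  exact ⟨_, _, _, _, _, _, _, _, _, _, _, _, _, _, _, _, _, _, _, _, _, _,
    (isTwinPresentation_presLabel k R).congr (coprodIBoolMulEquiv _), hray false, hray true,
    StarQuiver.isWedge_rayMap _ _, StarQuiver.labelIdeal_eq_coproductIdeal _,
    StarQuiver.labelIdeal_eq_coproductIdeal _⟩

theorem hasTwinWedge_coprod {G₁ G₂ : Type*} [Group G₁] [Group G₂]
    [Group.IsFinitelyPresented G₁] [Group.IsFinitelyPresented G₂] :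
    HasTwinWedge k G₁ G₂ (Monoid.Coprod G₁ G₂) := by
  obtain ⟨n₁, R₁, hR₁, ⟨e₁⟩⟩ := Group.IsFinitelyPresented.exists_mulEquiv_presentedGroup (G := G₁)
  obtain ⟨n₂, R₂, hR₂, ⟨e₂⟩⟩ := Group.IsFinitelyPresented.exists_mulEquiv_presentedGroup (G := G₂)
  exact (hasTwinWedge_presentedGroup (α := fun j => Fin (bif j then n₂ else n₁))
    (fun | false => R₁ | true => R₂) fun | false => hR₁ | true => hR₂).congr e₁.symm e₂.symm
      (MulEquiv.coprodCongr e₁.symm e₂.symm)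

end HasTwinWedge

/-! ### Splitting off the free generators -/

theorem mem_toWord_of_mem_toWord_map {α β : Type*} [DecidableEq α] [DecidableEq β] {κ : α → β}
    (hκ : Function.Injective κ) {x : FreeGroup α} {i : α} {b : Bool}
    (h : (κ i, b) ∈ (FreeGroup.map κ x).toWord) : (i, b) ∈ x.toWord := by
  rw [← FreeGroup.mk_toWord (x := x), FreeGroup.map.mk, FreeGroup.toWord_mk] at h
  obtain ⟨⟨i', b'⟩, hmem, heq⟩ :=
    List.mem_map.mp ((FreeGroup.Red.sublist FreeGroup.reduce.red).subset h)
  obtain ⟨hi, rfl⟩ := Prod.mk.inj heq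
  rwa [← hκ hi]

theorem mem_range_map_of_forall_mem_toWord {α β : Type*} [DecidableEq β] {κ : α → β}
    {x : FreeGroup β} (h : ∀ i b, (i, b) ∈ x.toWord → i ∈ Set.range κ) :
    x ∈ Set.range (FreeGroup.map κ) := by
  have hword : x.toWord ∈ Set.range (List.map fun y : α × Bool => (κ y.1, y.2)) := by
    rw [Set.range_list_map]
    rintro ⟨i, b⟩ hib
    obtain ⟨a, rfl⟩ := h i b hib
    exact ⟨(a, b), rfl⟩
  obtain ⟨l, hl⟩ := hword
  exact ⟨FreeGroup.mk l, by rw [FreeGroup.map.mk, hl, FreeGroup.mk_toWord]⟩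

/-- The group without relators is the free group. -/
def presentedGroupEmptyMulEquiv (α : Type*) :
    PresentedGroup (∅ : Set (FreeGroup α)) ≃* FreeGroup α :=
  (QuotientGroup.quotientMulEquivOfEq Subgroup.normalClosure_empty).trans QuotientGroup.quotientBot

theorem nonempty_presentedGroup_image_mulEquiv_coprod {α β γ : Type*} (ε : α ⊕ β ≃ γ)
    (R : Set (FreeGroup β)) :
    Nonempty (PresentedGroup (FreeGroup.map (fun i => ε (.inr i)) '' R) ≃*
      Monoid.Coprod (FreeGroup α) (PresentedGroup R)) := by
  have himage : FreeGroup.freeGroupCongr ε ''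
      (FreeGroup.map Sum.inl '' ∅ ∪ FreeGroup.map Sum.inr '' R) =
        FreeGroup.map (fun i => ε (.inr i)) '' R := by
    rw [Set.image_empty, Set.empty_union, Set.image_image]
    exact Set.image_congr fun r _ => FreeGroup.map.comp ..
  rw [← himage]
  exact ⟨(PresentedGroup.equivPresentedGroup _ ε).symm.trans
    ((PresentedGroup.coprodPresentations ∅ R).trans
      (MulEquiv.coprodCongr (presentedGroupEmptyMulEquiv α) (MulEquiv.refl _)))⟩

theorem exists_mulEquiv_coprod_freeGroup (G : Type*) [Group G] [Group.IsFinitelyPresented G] :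
    ∃ (m : ℕ) (H : Type) (_ : Group H), HasPresentationWithoutFreeGenerators H ∧
      Nonempty (G ≃* Monoid.Coprod (FreeGroup (Fin m)) H) := by
  classical
  obtain ⟨n, R, hR, ⟨e⟩⟩ := Group.IsFinitelyPresented.exists_mulEquiv_presentedGroup (G := G)
  let used (i : Fin n) : Prop := ∃ r ∈ R, ∃ b : Bool, (i, b) ∈ r.toWord
  let ε : Fin (Fintype.card {i // ¬ used i}) ⊕ Fin (Fintype.card {i // used i}) ≃ Fin n :=
    (Equiv.sumComm _ _).trans (((Fintype.equivFin _).symm.sumCongr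
      (Fintype.equivFin _).symm).trans (Equiv.sumCompl used))
  let κ := FreeGroup.map fun i => ε (.inr i)
  have hε : Function.Injective fun i => ε (.inr i) := ε.injective.comp Sum.inr_injective
  have hused (i) : used (ε (.inr i)) := ((Fintype.equivFin _).symm i).2
  have hrange : R ⊆ Set.range κ := fun r hr => mem_range_map_of_forall_mem_toWord
    fun i b hi => ⟨Fintype.equivFin _ ⟨i, r, hr, b, hi⟩, by simp [ε]⟩
  obtain ⟨e'⟩ := nonempty_presentedGroup_image_mulEquiv_coprod ε (κ ⁻¹' R)
  rw [Set.image_preimage_eq_of_subset hrange] at e'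
  refine ⟨_, _, inferInstance, ⟨_, κ ⁻¹' R, hR.preimage (FreeGroup.map_injective hε).injOn,
    fun i => ?_, ⟨MulEquiv.refl _⟩⟩, ⟨e.trans e'⟩⟩
  obtain ⟨r, hr, b, hb⟩ := hused i
  obtain ⟨y, rfl⟩ := hrange hr
  exact ⟨y, hr, b, mem_toWord_of_mem_toWord_map hε hb⟩

theorem HasPresentationWithoutFreeGenerators.isFinitelyPresented {H : Type*} [Group H]
    (h : HasPresentationWithoutFreeGenerators H) : Group.IsFinitelyPresented H := by
  obtain ⟨n, R, hR, -, ⟨e⟩⟩ := h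
  have := hR.to_subtype
  exact .equiv e

end BoundQuiver

end

theorem mainTheorem3_general (k : Type u) [Field k] (G : Type v) [Group G]
    [Group.IsFinitelyPresented G] :
    (∃ (m : ℕ) (H : Type) (_ : Group H),
      BoundQuiver.HasPresentationWithoutFreeGenerators H ∧
        Nonempty (G ≃* Monoid.Coprod (FreeGroup (Fin m)) H)) ∧
    ∀ (G₁ G₂ : Type*) [Group G₁] [Group G₂] [Group.IsFinitelyPresented G₁]
      [Group.IsFinitelyPresented G₂], Nonempty (G ≃* Monoid.Coprod G₁ G₂) →
      BoundQuiver.HasTwinWedge k G₁ G₂ G :=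
  ⟨BoundQuiver.exists_mulEquiv_coprod_freeGroup G, fun _ _ _ _ _ _ ⟨e⟩ =>
    BoundQuiver.hasTwinWedge_coprod.congr (.refl _) (.refl _) e.symm⟩

theorem mainTheorem3 (k : Type u) [Field k] (G : Type v) [Group G]
    [Group.IsFinitelyPresented G] :
    (∃ (m : ℕ) (H : Type) (_ : Group H),
      BoundQuiver.HasPresentationWithoutFreeGenerators H ∧
        Nonempty (G ≃* Monoid.Coprod (FreeGroup (Fin m)) H)) ∧
    ∀ (m : ℕ) (H : Type w) [Group H],
      BoundQuiver.HasPresentationWithoutFreeGenerators H →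
      Nonempty (G ≃* Monoid.Coprod (FreeGroup (Fin m)) H) →
      ∃ (O QH QG : BoundQuiver.FinConnQuiver)
        (L L' : Ideal (BoundQuiver.PathAlgebra k O.Vert))
        (I I' : Ideal (BoundQuiver.PathAlgebra k QH.Vert))
        (J J' : Ideal (BoundQuiver.PathAlgebra k QG.Vert))
        (AO : Type u) (_ : Ring AO) (_ : Algebra k AO)
        (AH : Type u) (_ : Ring AH) (_ : Algebra k AH)
        (A : Type u) (_ : Ring A) (_ : Algebra k A)
        (ι₁ : O.Vert ⥤q QG.Vert) (ι₂ : QH.Vert ⥤q QG.Vert) (v₁ : O.Vert) (v₂ : QH.Vert),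
        BoundQuiver.IsTwinPresentation k QG J J' A G ∧
        BoundQuiver.IsTwinPresentation k O L L' AO (FreeGroup (Fin m)) ∧
        BoundQuiver.IsTwinPresentation k QH I I' AH H ∧
        BoundQuiver.IsWedge ι₁ ι₂ v₁ v₂ ∧
        J = BoundQuiver.coproductIdeal ι₁ ι₂ L I ∧
        J' = BoundQuiver.coproductIdeal ι₁ ι₂ L' I' := by
  obtain ⟨hsplit, hwedge⟩ := mainTheorem3_general k G
  refine ⟨hsplit, fun m H _ hH e => ?_⟩
  have := hH.isFinitelyPresented
  exact hwedge _ H e
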